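/- **Setting.** Let $\mathcal N$ be a finite non-empty set of servers, $N=|\mathcal N|$, let $\mathcal L\subseteq\mathcal N\times\mathcal N$ be a set of directed links, and let $\triangle(\mathcal N)$ be the set of probability distributions on $\mathcal N$. An oblivious adversary fixes in advance capacities $C_{n,m}(t)\in[0,M]$, $(n,m)\in\mathcal L$, and arrival rates $\lambda_n^{(k)}(t)\in[0,R]$, $n,k\in\mathcal N$, for the rounds $t=1,\dots,T$. In round $t$ the scheduler, who knows the past but neither $C(t)$ nor $\lambda(t)$, chooses $\bm a_{n,m}(t)\in\triangle(\mathcal N)$ for each link. Then random amounts $\mu_{n,m}^{(k)}(t)\in[0,M]$ are transmitted whose mean, given the past, is $C_{n,m}(t)\,a_{n,m}^{(k)}(t)$. The queues start at $Q_n^{(k)}(1)=0$; for all $t$, $Q_n^{(n)}(t+1)=0$ and, for $k\neq n$, $$Q_n^{(k)}(t+1)=\Big[Q_n^{(k)}(t)-\sum_{(n,m)\in\mathcal L}\mu_{n,m}^{(k)}(t)\Big]_+ +\sum_{(o,n)\in\mathcal L}\mu_{o,n}^{(k)}(t)+\lambda_n^{(k)}(t).$$ Write $\|\bm Q(t)\|_1=\sum_{n,k}|Q_n^{(k)}(t)|$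 and $\bm Q_n(t)=(Q_n^{(k)}(t))_{k\in\mathcal N}$. **Algorithm.** A *PFOL algorithm with constant $K$* on $X=\triangle(\mathcal N)$ is a deterministic (measurable) rule that picks $\bm x_t\in X$ from the loss vectors $\bm g_1,\dots,\bm g_{t-1}\in\mathbb R^{\mathcal N}$ such that for all $T$, all losses with $\|\bm g_t\|_\infty\le 1$ and all $\bm u_1,\dots,\bm u_T\in X$, with $D=\sup_{\bm x,\bm y\in X}\|\bm x-\bm y\|_1$, $$\sum_{t=1}^T\langle \bm g_t,\bm x_t-\bm u_t\rangle\le K\sqrt{D\Big(D+\sum_{t=1}^{T-1}\|\bm u_t-\bm u_{t+1}\|_1\Big)}\sqrt{1+\sum_{t=1}^T\|\bm g_t\|_\infty^2}\;\log\Big(2+T\sum_{t=1}^T\|\bm g_t\|_\infty^2\Big).$$ AdaPFOL starts with $G=1$ and a fresh copy of the PFOL algorithm; in each round it is told a magnitude $G_t$; if $G_t>G$ it sets $G=2G_t$ and restarts a fresh copy; it plays the output of the current copy, and then feeds $G^{-1}\bm g_t$ to it. NSO runs one AdaPFOL on each link $(n,m)$, with magnitudes $G_t=M\|\bm Q_m(t)-\bm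 Q_n(t)\|_\infty$ and losses $\bm g_t=C_{n,m}(t)(\bm Q_m(t)-\bm Q_n(t))$, and uses its output as $\bm a_{n,m}(t)$. **Multi-hop piecewise stability.** Allocations $\mathring{\bm a}_{n,m}(t)\in\triangle(\mathcal N)$ are piecewise stable with constants $C_W\ge0$, $\epsilon_W>0$ if $\{1,\dots,T\}$ can be partitioned into non-empty intervals $W_1,\dots,W_J$ with $\sum_j(|W_j|-1)^2\le C_WT$ such that for all $j$ and all $n\ne k$, $$\frac1{|W_j|}\sum_{t\in W_j}\sum_{(n,m)\in\mathcal L}C_{n,m}(t)\mathring a_{n,m}^{(k)}(t)\ \ge\ \epsilon_W+\frac1{|W_j|}\sum_{t\in W_j}\Big(\lambda_n^{(k)}(t)+\sum_{(o,n)\in\mathcal L}C_{o,n}(t)\mathring a_{o,n}^{(k)}(t)\Big).$$ **Theorem (Main Theorem for Multi-Hop Network Stability).** For every $\mathcal N$ there is, for some $K$, a PFOL algorithm with constant $K$ on $\triangle(\mathcal N)$. Moreover there is an absolute constant $c>0$ such that for all $\mathcal N$, $M,R,C_W\ge0$, $\epsilon_W,\delta_a>0$ and $C^a,K\in\mathbb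 R$ there are a function $r$ with $r(T)\to0$ as $T\to\infty$ and a number $B$, depending only on these parameters, such that the following holds for every $T\ge1$, every set of links, every capacities and arrival rates as above, and every PFOL algorithm with constant $K$. If some piecewise stable reference sequence with constants $C_W,\epsilon_W$ has path length $$P_t^a=\sum_{s=1}^{t-1}\sum_{(n,m)\in\mathcal L}\|\mathring{\bm a}_{n,m}(s)-\mathring{\bm a}_{n,m}(s+1)\|_1\le C^a\,t^{1/2-\delta_a}\qquad(t=1,\dots,T),$$ then under NSO with AdaPFOL the total queue length $\sum_{t\le T}\|\bm Q(t)\|_1$ is integrable and $$\frac1T\,\mathbb E\Big[\sum_{t=1}^T\|\bm Q(t)\|_1\Big]\le c\,\frac{\big(N^2(2NM+R)^2+\epsilon_WN^2(2NM+R)\big)C_W+N^4M^2+N^2R^2}{\epsilon_W}+r(T).$$ In particular $\frac1T\mathbb E[\sum_{t=1}^T\|\bm Q(t)\|_1]\le B$ for all $T\ge 1$, so the network is stable. -/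

import Mathlib

open Filter Topology MeasureTheory

noncomputable section

/-! Rounds are numbered from `0`: index `t` in Lean is round `t + 1` of a `T`-round game, so that
the rounds of the game are the elements of `Finset.range T`. -/

/-! ### Online linear optimization -/

/-- The `ℓ¹` norm on `ℝ^ι`. (The norm `‖·‖` which Mathlib puts on `ι → ℝ` is the `ℓ^∞` norm.) -/
def l1norm {ι : Type*} [Fintype ι] (x : ι → ℝ) : ℝ := ∑ i, |x i|

/-- The `ℓ¹` diameter `D = sup_{x, y ∈ X} ‖x - y‖₁` of an action set. -/
def l1diam {ι : Type*} [Fintype ι] (X : Set (ι → ℝ)) : ℝ :=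
  sSup {d : ℝ | ∃ x ∈ X, ∃ y ∈ X, d = l1norm (x - y)}

/-- A (deterministic, full-information) online linear optimization algorithm with action set `X`:
having observed `n` loss vectors, it plays a point of `X`. -/
structure OLOAlgorithm {ι : Type*} [Fintype ι] (X : Set (ι → ℝ)) where
  /-- the action played after the losses `h 0, …, h (n - 1)` have been observed -/
  play : (n : ℕ) → (Fin n → ι → ℝ) → ι → ℝ
  play_mem : ∀ n h, play n h ∈ X
  measurable_play : ∀ n, Measurable (play n)

/-- The action of `A` in round `t` against the loss sequence `g`; it uses `g 0, …, g (t - 1)`. -/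
def OLOAlgorithm.action {ι : Type*} [Fintype ι] {X : Set (ι → ℝ)} (A : OLOAlgorithm X)
    (g : ℕ → ι → ℝ) (t : ℕ) : ι → ℝ :=
  A.play t (fun i => g i)

/-- Dynamic regret `∑_{t < T} ⟨g_t, x_t - u_t⟩` against the comparators `u`. -/
def dynamicRegret {ι : Type*} [Fintype ι] (T : ℕ) (g x u : ℕ → ι → ℝ) : ℝ :=
  ∑ t ∈ Finset.range T, ∑ i, g t i * (x t i - u t i)

/-- The parameter-free dynamic regret guarantee with constant `K`: for every horizon `T`, all
losses with `‖g_t‖_∞ ≤ 1` and all comparators `u_t ∈ X`, the dynamic regret is at most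
`K √(D (D + ∑ ‖u_t - u_{t+1}‖₁)) √(1 + ∑ ‖g_t‖_∞²) log (2 + T ∑ ‖g_t‖_∞²)`. -/
def IsPFOL {ι : Type*} [Fintype ι] {X : Set (ι → ℝ)} (A : OLOAlgorithm X) (K : ℝ) : Prop :=
  ∀ (T : ℕ) (g u : ℕ → ι → ℝ),
    (∀ t < T, ‖g t‖ ≤ 1) → (∀ t < T, u t ∈ X) →
    dynamicRegret T g (A.action g) u ≤
      K * √(l1diam X * (l1diam X + ∑ t ∈ Finset.range (T - 1), l1norm (u t - u (t + 1)))) *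
        √(1 + ∑ t ∈ Finset.range T, ‖g t‖ ^ 2) *
        Real.log (2 + T * ∑ t ∈ Finset.range T, ‖g t‖ ^ 2)

/-- The state `(G, s)` of AdaPFOL in round `t`, after the magnitude `Gmax t` has been compared
with `G`: the current scale `G`, and the round `s` in which the current instance of the base
algorithm was started. -/
def adaPFOLState (Gmax : ℕ → ℝ) : ℕ → ℝ × ℕ
  | 0 => if Gmax 0 > 1 then (2 * Gmax 0, 0) else (1, 0)
  | t + 1 =>
      if Gmax (t + 1) > (adaPFOLState Gmax t).1 then (2 * Gmax (t + 1), t + 1)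
      else adaPFOLState Gmax t

/-- The output of AdaPFOL in round `t`: the current instance of the base algorithm `A` has been
fed the losses `G⁻¹ g_s, …, G⁻¹ g_{t-1}` since it was started in round `s`. -/
def adaPFOL {ι : Type*} [Fintype ι] {X : Set (ι → ℝ)} (A : OLOAlgorithm X)
    (Gmax : ℕ → ℝ) (g : ℕ → ι → ℝ) (t : ℕ) : ι → ℝ :=
  A.play (t - (adaPFOLState Gmax t).2)
    (fun i => (adaPFOLState Gmax t).1⁻¹ • g ((adaPFOLState Gmax t).2 + i))

/-! ### The multi-hop network -/

/-- A multi-hop network with server set `𝒩` in an oblivious adversarial environment: the directed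
links, the link capacities `C_{n,m}(t)`, and the arrival rates `λ_n^{(k)}(t)` (`arrival t n k`). -/
structure Network (𝒩 : Type*) where
  links : Finset (𝒩 × 𝒩)
  cap : ℕ → 𝒩 × 𝒩 → ℝ
  arrival : ℕ → 𝒩 → 𝒩 → ℝ

namespace Network

variable {𝒩 : Type*} [Fintype 𝒩] [DecidableEq 𝒩]

/-- During the first `T` rounds, capacities lie in `[0, M]` and arrival rates in `[0, R]`. -/
def IsBounded (net : Network 𝒩) (T : ℕ) (M R : ℝ) : Prop :=
  (∀ t < T, ∀ l ∈ net.links, net.cap t l ∈ Set.Icc 0 M) ∧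
  (∀ t < T, ∀ n k, net.arrival t n k ∈ Set.Icc 0 R)

/-- The total of `f l k` over the links leaving `n`. -/
def outflow (net : Network 𝒩) (f : 𝒩 × 𝒩 → 𝒩 → ℝ) (n k : 𝒩) : ℝ :=
  ∑ l ∈ net.links with l.1 = n, f l k

/-- The total of `f l k` over the links entering `n`. -/
def inflow (net : Network 𝒩) (f : 𝒩 × 𝒩 → 𝒩 → ℝ) (n k : 𝒩) : ℝ :=
  ∑ l ∈ net.links with l.2 = n, f l k

/-- The queue lengths `Q_n^{(k)}(t)` (`queue mu t n k`) at the beginning of round `t`, for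
transmissions `mu t (n, m) k = μ_{n,m}^{(k)}(t)`. The network starts empty. -/
def queue (net : Network 𝒩) (mu : ℕ → 𝒩 × 𝒩 → 𝒩 → ℝ) : ℕ → 𝒩 → 𝒩 → ℝ
  | 0 => fun _ _ => 0
  | t + 1 => fun n k =>
      if k = n then 0
      else max (net.queue mu t n k - net.outflow (mu t) n k) 0
        + net.inflow (mu t) n k + net.arrival t n k

/-- `∑_{t < T} ‖Q(t)‖₁`. -/
def totalQueue (net : Network 𝒩) (mu : ℕ → 𝒩 × 𝒩 → 𝒩 → ℝ) (T : ℕ) : ℝ :=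
  ∑ t ∈ Finset.range T, ∑ n, l1norm (net.queue mu t n)

/-- The link allocation `a_{n,m}(t)`, `l = (n, m)`, which NSO computes when every link runs its own
copy of AdaPFOL with base algorithm `A`, fed with the magnitudes `M ‖Q_m(t) - Q_n(t)‖_∞` and the
losses `C_{n,m}(t) (Q_m(t) - Q_n(t))`. -/
def nsoAction (net : Network 𝒩) (M : ℝ) (A : OLOAlgorithm (stdSimplex ℝ 𝒩))
    (mu : ℕ → 𝒩 × 𝒩 → 𝒩 → ℝ) (t : ℕ) (l : 𝒩 × 𝒩) : 𝒩 → ℝ :=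
  adaPFOL A (fun s => M * ‖net.queue mu s l.2 - net.queue mu s l.1‖)
    (fun s => net.cap s l • (net.queue mu s l.2 - net.queue mu s l.1)) t

/-- The σ-algebra generated by all transmissions before round `t`. -/
@[reducible] def history {Ω : Type*} (net : Network 𝒩) (mu : ℕ → 𝒩 × 𝒩 → 𝒩 → Ω → ℝ) (t : ℕ) :
    MeasurableSpace Ω :=
  ⨆ s < t, ⨆ l ∈ net.links, ⨆ k, MeasurableSpace.comap (mu s l k) inferInstance

/-- The random transmissions `mu` come from running NSO with AdaPFOL for `T` rounds: they lie in
`[0, M]`, and given the past, `μ_{n,m}^{(k)}(t)` has mean `C_{n,m}(t) a_{n,m}^{(k)}(t)`, where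
`a(t)` is the allocation chosen by NSO. -/
structure IsNSORun {Ω : Type*} [MeasurableSpace Ω] (P : Measure Ω) (net : Network 𝒩) (T : ℕ)
    (M : ℝ) (A : OLOAlgorithm (stdSimplex ℝ 𝒩)) (mu : ℕ → 𝒩 × 𝒩 → 𝒩 → Ω → ℝ) : Prop where
  measurable : ∀ t < T, ∀ l ∈ net.links, ∀ k, Measurable (mu t l k)
  mem_Icc : ∀ t < T, ∀ l ∈ net.links, ∀ k, ∀ᵐ ω ∂P, mu t l k ω ∈ Set.Icc 0 M
  condExp_eq : ∀ t < T, ∀ l ∈ net.links, ∀ k,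
    P[mu t l k | net.history mu t] =ᵐ[P]
      fun ω => net.cap t l * net.nsoAction M A (fun s l' k' => mu s l' k' ω) t l k

/-- Multi-hop piecewise stability of the reference allocations `a` on the first `T` rounds: the
rounds can be partitioned into intervals `W_j` with `∑_j (|W_j| - 1)² ≤ C_W T` such that, on each
of them, the average service of every queue `Q_n^{(k)}`, `k ≠ n`, exceeds its average arrivals by
at least `ε_W`. (`Q_n^{(n)}` is identically `0` and is not a queue that has to be served.) -/
def PiecewiseStable (net : Network 𝒩) (T : ℕ) (CW εW : ℝ) (a : ℕ → 𝒩 × 𝒩 → 𝒩 → ℝ) : Prop :=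
  (∀ t < T, ∀ l ∈ net.links, a t l ∈ stdSimplex ℝ 𝒩) ∧
  ∃ W : Finpartition (Finset.range T),
    (∀ w ∈ W.parts, ∃ i j : ℕ, w = Finset.Ico i j) ∧
    ∑ w ∈ W.parts, ((w.card : ℝ) - 1) ^ 2 ≤ CW * T ∧
    ∀ w ∈ W.parts, ∀ n k : 𝒩, k ≠ n →
      1 / (w.card : ℝ) * ∑ t ∈ w, net.outflow (fun l k => net.cap t l * a t l k) n k ≥
        εW + 1 / (w.card : ℝ) * ∑ t ∈ w,
          (net.arrival t n k + net.inflow (fun l k => net.cap t l * a t l k) n k)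

/-- The path length of `a` over the first `t` rounds,
`∑_{s=1}^{t-1} ∑_{(n,m)} ‖a_{n,m}(s) - a_{n,m}(s+1)‖₁`. -/
def pathLength (net : Network 𝒩) (a : ℕ → 𝒩 × 𝒩 → 𝒩 → ℝ) (t : ℕ) : ℝ :=
  ∑ s ∈ Finset.range (t - 1), ∑ l ∈ net.links, l1norm (a s l - a (s + 1) l)

end Network

end

/-!
The theorem has two halves, which meet only in the guarantee `IsPFOL`.

*A parameter-free algorithm on the simplex.* Projected gradient descent with step size `γ` has
dynamic regret at most `(1 + P) / γ + γ N V / 2` (`gradientDescent_regret`), where `P` is the path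
length of the comparators, `V` the sum of the squared loss norms and `N` the dimension. The optimal
`γ ≈ √((1 + P) / (1 + V))` is unknown, so gradient descent is run with every step size `2^j`,
`j ∈ ℤ`, and the actions are averaged with exponential weights. The log-weights carry a second
order correction, `exp (y - 2 y²) ≤ 1 + y`, which lets every expert have its own learning rate and
keeps the total weight bounded (`sum_exp_expertLogWeight_le`). With prior weight `2^{-(i+1)}` the
price for the expert `i` is linear in `i`, hence logarithmic in its step size, and this is the
logarithm in the definition of `IsPFOL` (`gridDescent_regret`).

*Stability.* The scale `G` of AdaPFOL at least doubles at each restart, so that its regret on a link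
is at most a multiple of `√(D (D + P)) log (2 + T²) √(G (G + ∑ ‖g_t‖))` for the final scale `G`
(`adaPFOL_regret`). On each sample path there are two opposite estimates for
`∑ ⟨Q(t), net service⟩`. By the Lyapunov function `‖Q‖₂² / 2`, it is at most of order `T` for the
actual transmissions (`sum_drain_le`). By piecewise stability, it is at least
`εW ∑ ‖Q(t)‖₁ - O(CW T)` for the reference allocations (`mul_totalQueue_le`), and NSO loses at most
its regret against these. In expectation the transmissions may be replaced by their conditional
means, as the queues are determined by the past (`integral_sum_drain_sub`).

It remains to absorb the regret, whose size depends on the queues themselves. Queues have bounded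
increments, so `max_t ‖Q(t)‖₁² = O(S)` for `S = ∑ ‖Q(t)‖₁` (`sq_queueNorm_le`), and the regret is
`O(T^{1/4 - δ/2} log T (1 + S)^{3/4})` (`link_regret_le`), where
`δ = min δa (1/4)`. By Young's inequality (`mul_pow_three_le`) this is at most
`εW S / 2 + O(T^{1 - 2δ} log⁴ T)`, and the last term is the remainder `T r(T)`.
-/

/-! ### The `ℓ¹` norm and the simplex -/

section Simplex

variable {ι : Type*} [Fintype ι]

theorem l1norm_nonneg (x : ι → ℝ) : 0 ≤ l1norm x :=
  Finset.sum_nonneg fun _ _ => abs_nonneg _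

theorem dotProduct_le_norm_mul_l1norm (g x : ι → ℝ) : g ⬝ᵥ x ≤ ‖g‖ * l1norm x := by
  unfold dotProduct l1norm
  rw [Finset.mul_sum]
  refine Finset.sum_le_sum fun i _ => (le_abs_self _).trans ?_
  rw [abs_mul]
  exact mul_le_mul_of_nonneg_right (norm_le_pi_norm g i) (abs_nonneg _)

theorem abs_dotProduct_le_norm_mul_l1norm (g x : ι → ℝ) : |g ⬝ᵥ x| ≤ ‖g‖ * l1norm x := by
  refine abs_le.2 ⟨?_, dotProduct_le_norm_mul_l1norm g x⟩
  have := dotProduct_le_norm_mul_l1norm (-g) x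
  rw [neg_dotProduct, norm_neg] at this
  linarith

theorem dotProduct_self_le_card_mul_sq_norm (g : ι → ℝ) :
    g ⬝ᵥ g ≤ Fintype.card ι * ‖g‖ ^ 2 := by
  unfold dotProduct
  calc ∑ i, g i * g i ≤ ∑ _i : ι, ‖g‖ ^ 2 := by
        refine Finset.sum_le_sum fun i _ => ?_
        have h := norm_le_pi_norm g i
        rw [← abs_mul_abs_self, sq]
        exact mul_self_le_mul_self (abs_nonneg _) h
    _ = _ := by simp

theorem l1norm_sub_le_two {x y : ι → ℝ} (hx : x ∈ stdSimplex ℝ ι) (hy : y ∈ stdSimplex ℝ ι) :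
    l1norm (x - y) ≤ 2 := by
  unfold l1norm
  calc ∑ i, |(x - y) i| ≤ ∑ i, (x i + y i) := by
        refine Finset.sum_le_sum fun i _ => ?_
        have h1 := hx.1 i
        have h2 := hy.1 i
        rw [Pi.sub_apply, abs_le]
        constructor <;> linarith
    _ = 2 := by rw [Finset.sum_add_distrib, hx.2, hy.2]; norm_num

theorem apply_le_one_of_mem_stdSimplex {x : ι → ℝ} (hx : x ∈ stdSimplex ℝ ι) (i : ι) :
    x i ≤ 1 := by
  rw [← hx.2]
  exact Finset.single_le_sum (fun j _ => hx.1 j) (Finset.mem_univ i)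

theorem dotProduct_self_sub_le_two {x y : ι → ℝ} (hx : x ∈ stdSimplex ℝ ι)
    (hy : y ∈ stdSimplex ℝ ι) : (x - y) ⬝ᵥ (x - y) ≤ 2 := by
  refine (dotProduct_le_norm_mul_l1norm _ _).trans ?_
  have h1 : ‖x - y‖ ≤ 1 := by
    refine (pi_norm_le_iff_of_nonneg zero_le_one).2 fun i => ?_
    have := hx.1 i
    have := hy.1 i
    have := apply_le_one_of_mem_stdSimplex hx i
    have := apply_le_one_of_mem_stdSimplex hy i
    rw [Pi.sub_apply, Real.norm_eq_abs, abs_le]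
    constructor <;> linarith
  have h2 := l1norm_sub_le_two hx hy
  nlinarith [l1norm_nonneg (x - y)]

theorem l1diam_stdSimplex_le_two : l1diam (stdSimplex ℝ ι) ≤ 2 := by
  refine Real.sSup_le ?_ (by norm_num)
  rintro d ⟨x, hx, y, hy, rfl⟩
  exact l1norm_sub_le_two hx hy

theorem two_le_l1diam_stdSimplex [Nontrivial ι] : 2 ≤ l1diam (stdSimplex ℝ ι) := by
  classical
  obtain ⟨i, j, hij⟩ := exists_pair_ne ι
  refine le_csSup ⟨2, ?_⟩ ⟨Pi.single i 1, single_mem_stdSimplex ℝ i, Pi.single j 1,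
    single_mem_stdSimplex ℝ j, ?_⟩
  · rintro d ⟨x, hx, y, hy, rfl⟩
    exact l1norm_sub_le_two hx hy
  · unfold l1norm
    have hk : ∀ k, |(Pi.single i (1 : ℝ) - Pi.single j 1 : ι → ℝ) k|
        = (Pi.single i (1 : ℝ) : ι → ℝ) k + (Pi.single j 1 : ι → ℝ) k := by
      intro k
      by_cases h1 : k = i
      · subst h1
        simp [hij]
      · by_cases h2 : k = j
        · subst h2
          simp [h1]
        · simp [h1, h2]
    simp only [hk, Finset.sum_add_distrib]
    simp
    norm_num

end Simplex

/-! ### Euclidean projection -/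

section Projection

variable {E : Type*} [NormedAddCommGroup E] [InnerProductSpace ℝ E]

/-- The nearest point of the set `s` to `x`; it is `x` itself if no nearest point exists. -/
noncomputable def nearestPoint (s : Set E) (x : E) : E :=
  open Classical in
  if h : ∃ p ∈ s, ‖x - p‖ = ⨅ w : s, ‖x - w‖ then h.choose else x

variable {s : Set E}

theorem nearestPoint_spec (hne : s.Nonempty) (hc : IsComplete s)
    (hconv : Convex ℝ s) (x : E) :
    nearestPoint s x ∈ s ∧ ‖x - nearestPoint s x‖ = ⨅ w : s, ‖x - w‖ := by
  have h := exists_norm_eq_iInf_of_complete_convex hne hc hconv x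
  rw [nearestPoint, dif_pos h]
  exact h.choose_spec

theorem inner_sub_nearestPoint_le_zero (hne : s.Nonempty) (hc : IsComplete s)
    (hconv : Convex ℝ s) (x : E) {w : E} (hw : w ∈ s) :
    inner ℝ (x - nearestPoint s x) (w - nearestPoint s x) ≤ 0 :=
  have h := nearestPoint_spec hne hc hconv x
  (norm_eq_iInf_iff_real_inner_le_zero hconv h.1).1 h.2 w hw

theorem lipschitzWith_nearestPoint (hne : s.Nonempty) (hc : IsComplete s)
    (hconv : Convex ℝ s) : LipschitzWith 1 (nearestPoint s) := by
  refine LipschitzWith.of_dist_le_mul fun x y => ?_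
  rw [NNReal.coe_one, one_mul, dist_eq_norm, dist_eq_norm]
  set p := nearestPoint s x with hp
  set q := nearestPoint s y with hq
  have h1 := inner_sub_nearestPoint_le_zero hne hc hconv x
    (nearestPoint_spec hne hc hconv y).1
  have h2 := inner_sub_nearestPoint_le_zero hne hc hconv y
    (nearestPoint_spec hne hc hconv x).1
  rw [← hp, ← hq] at h1 h2
  have h3 : inner ℝ (p - q) (p - q) ≤ inner ℝ (x - y) (p - q) := by
    have e : inner ℝ (x - y) (p - q) - inner ℝ (p - q) (p - q)
        = -inner ℝ (x - p) (q - p) - inner ℝ (y - q) (p - q) := by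
      simp only [inner_sub_left, inner_sub_right]
      ring
    linarith
  have h4 := h3.trans (real_inner_le_norm _ _)
  rw [real_inner_self_eq_norm_sq, sq] at h4
  by_contra hlt
  push Not at hlt
  have h5 : 0 < ‖p - q‖ := (norm_nonneg _).trans_lt hlt
  nlinarith

/-- Projecting onto a convex set brings a point closer to every point of the set. -/
theorem norm_nearestPoint_sub_sq_le (hne : s.Nonempty) (hc : IsComplete s)
    (hconv : Convex ℝ s) (x : E) {w : E} (hw : w ∈ s) :
    ‖nearestPoint s x - w‖ ^ 2 ≤ ‖x - w‖ ^ 2 := by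
  have h := inner_sub_nearestPoint_le_zero hne hc hconv x hw
  set p := nearestPoint s x
  have e : ‖x - w‖ ^ 2 = ‖x - p‖ ^ 2 - 2 * inner ℝ (x - p) (w - p) + ‖p - w‖ ^ 2 := by
    have : x - w = (x - p) - (w - p) := by abel
    rw [this, norm_sub_sq_real, norm_sub_rev w p]
  nlinarith [sq_nonneg ‖x - p‖]

end Projection

section SimplexProjection

variable {ι : Type*} [Fintype ι]

/-- The simplex as a subset of Euclidean space. -/
def euclideanSimplex (ι : Type*) [Fintype ι] : Set (EuclideanSpace ℝ ι) :=
  WithLp.ofLp ⁻¹' stdSimplex ℝ ι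

theorem euclideanSimplex_nonempty [Nonempty ι] : (euclideanSimplex ι).Nonempty := by
  classical
  exact ⟨WithLp.toLp 2 (Pi.single (Classical.arbitrary ι) 1), single_mem_stdSimplex ℝ _⟩

theorem isComplete_euclideanSimplex : IsComplete (euclideanSimplex ι) :=
  ((isClosed_stdSimplex ℝ ι).preimage (PiLp.continuous_ofLp 2 _)).isComplete

theorem convex_euclideanSimplex : Convex ℝ (euclideanSimplex ι) :=
  (convex_stdSimplex ℝ ι).linear_preimage (WithLp.linearEquiv 2 ℝ (ι → ℝ)).toLinearMap

/-- The Euclidean projection of `ℝ^ι` onto the simplex. -/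
noncomputable def simplexProj (x : ι → ℝ) : ι → ℝ :=
  WithLp.ofLp (nearestPoint (euclideanSimplex ι) (WithLp.toLp 2 x))

variable [Nonempty ι]

theorem simplexProj_mem (x : ι → ℝ) : simplexProj x ∈ stdSimplex ℝ ι :=
  (nearestPoint_spec euclideanSimplex_nonempty isComplete_euclideanSimplex
    convex_euclideanSimplex (WithLp.toLp 2 x)).1

theorem continuous_simplexProj : Continuous (simplexProj : (ι → ℝ) → ι → ℝ) :=
  (PiLp.continuous_ofLp 2 _).comp ((lipschitzWith_nearestPoint euclideanSimplex_nonempty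
    isComplete_euclideanSimplex convex_euclideanSimplex).continuous.comp
      (PiLp.continuous_toLp 2 _))

theorem simplexProj_sub_sq_le (x : ι → ℝ) {u : ι → ℝ} (hu : u ∈ stdSimplex ℝ ι) :
    (simplexProj x - u) ⬝ᵥ (simplexProj x - u) ≤ (x - u) ⬝ᵥ (x - u) := by
  have h := norm_nearestPoint_sub_sq_le euclideanSimplex_nonempty isComplete_euclideanSimplex
    convex_euclideanSimplex (WithLp.toLp 2 x) (w := WithLp.toLp 2 u) hu
  simp only [EuclideanSpace.real_norm_sq_eq, PiLp.sub_apply] at h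
  simpa only [simplexProj, sq, dotProduct, Pi.sub_apply] using h

end SimplexProjection

/-! ### Projected gradient descent -/

section GradientDescent

variable {ι : Type*} [Fintype ι]

/-- Projected online gradient descent with step size `γ` on the simplex: its action in round `t`
against the losses `g`. -/
noncomputable def gradientDescent (γ : ℝ) (g : ℕ → ι → ℝ) : ℕ → ι → ℝ
  | 0 => simplexProj 0
  | t + 1 => simplexProj (gradientDescent γ g t - γ • g t)

theorem gradientDescent_congr (γ : ℝ) {g g' : ℕ → ι → ℝ} {t : ℕ} (h : ∀ s < t, g s = g' s) :
    gradientDescent γ g t = gradientDescent γ g' t := by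
  induction t with
  | zero => rfl
  | succ t ih =>
    rw [gradientDescent, gradientDescent, ih fun s hs => h s (hs.trans t.lt_succ_self),
      h t t.lt_succ_self]

variable [Nonempty ι]

theorem gradientDescent_mem (γ : ℝ) (g : ℕ → ι → ℝ) (t : ℕ) :
    gradientDescent γ g t ∈ stdSimplex ℝ ι := by
  cases t <;> exact simplexProj_mem _

theorem measurable_gradientDescent (γ : ℝ) (t : ℕ) :
    Measurable fun g : ℕ → ι → ℝ => gradientDescent γ g t := by
  induction t with
  | zero => exact measurable_const
  | succ t ih =>
    exact continuous_simplexProj.measurable.comp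
      (ih.sub ((measurable_pi_apply t).const_smul γ))

/-- One step of gradient descent, with `‖x_t - u_t‖₂²` as potential. -/
theorem gradientDescent_step (γ : ℝ) (g : ℕ → ι → ℝ) (t : ℕ) {u v : ι → ℝ}
    (hu : u ∈ stdSimplex ℝ ι) (hv : v ∈ stdSimplex ℝ ι) :
    2 * γ * (g t ⬝ᵥ (gradientDescent γ g t - u)) ≤
      (gradientDescent γ g t - u) ⬝ᵥ (gradientDescent γ g t - u)
      - (gradientDescent γ g (t + 1) - v) ⬝ᵥ (gradientDescent γ g (t + 1) - v)
      + 2 * l1norm (u - v) + γ ^ 2 * (Fintype.card ι * ‖g t‖ ^ 2) := by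
  set x := gradientDescent γ g t with hx
  set y := gradientDescent γ g (t + 1) with hy
  have hym : y ∈ stdSimplex ℝ ι := gradientDescent_mem γ g (t + 1)
  have h1 : (y - u) ⬝ᵥ (y - u) ≤ (x - γ • g t - u) ⬝ᵥ (x - γ • g t - u) :=
    simplexProj_sub_sq_le _ hu
  have h2 : (x - γ • g t - u) ⬝ᵥ (x - γ • g t - u)
      = (x - u) ⬝ᵥ (x - u) - 2 * γ * (g t ⬝ᵥ (x - u)) + γ ^ 2 * (g t ⬝ᵥ g t) := by
    simp only [dotProduct, Finset.mul_sum, ← Finset.sum_sub_distrib, ← Finset.sum_add_distrib]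
    refine Finset.sum_congr rfl fun i _ => ?_
    simp only [Pi.sub_apply, Pi.smul_apply, smul_eq_mul]
    ring
  have h3 : (y - v) ⬝ᵥ (y - v) - (y - u) ⬝ᵥ (y - u) ≤ 2 * l1norm (u - v) := by
    simp only [dotProduct, l1norm, Finset.mul_sum, ← Finset.sum_sub_distrib]
    refine Finset.sum_le_sum fun i _ => ?_
    have e : (y - v) i * (y - v) i - (y - u) i * (y - u) i
        = (u - v) i * (2 * y i - u i - v i) := by
      simp only [Pi.sub_apply]
      ring
    rw [e]
    refine (le_abs_self _).trans ?_
    rw [abs_mul, mul_comm]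
    refine mul_le_mul_of_nonneg_right ?_ (abs_nonneg _)
    have := hym.1 i
    have := hu.1 i
    have := hv.1 i
    have := apply_le_one_of_mem_stdSimplex hym i
    have := apply_le_one_of_mem_stdSimplex hu i
    have := apply_le_one_of_mem_stdSimplex hv i
    rw [abs_le]
    constructor <;> linarith
  have h4 := mul_le_mul_of_nonneg_left (dotProduct_self_le_card_mul_sq_norm (g t)) (sq_nonneg γ)
  linarith

theorem gradientDescent_regret {γ : ℝ} (hγ : 0 < γ) (g u : ℕ → ι → ℝ)
    (hu : ∀ t, u t ∈ stdSimplex ℝ ι) {s T : ℕ} (hsT : s ≤ T) :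
    ∑ t ∈ Finset.Ico s T, g t ⬝ᵥ (gradientDescent γ g t - u t) ≤
      (1 + ∑ t ∈ Finset.range T, l1norm (u t - u (t + 1))) / γ
        + γ * (Fintype.card ι * ∑ t ∈ Finset.range T, ‖g t‖ ^ 2) / 2 := by
  have key : 2 * γ * ∑ t ∈ Finset.Ico s T, g t ⬝ᵥ (gradientDescent γ g t - u t) ≤
      2 + 2 * ∑ t ∈ Finset.Ico s T, l1norm (u t - u (t + 1))
        + γ ^ 2 * (Fintype.card ι * ∑ t ∈ Finset.Ico s T, ‖g t‖ ^ 2) := by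
    set φ : ℕ → ℝ := fun t => (gradientDescent γ g t - u t) ⬝ᵥ (gradientDescent γ g t - u t)
      with hφ
    have h := Finset.sum_le_sum fun t (_ : t ∈ Finset.Ico s T) =>
      gradientDescent_step γ g t (hu t) (hu (t + 1))
    have htel : ∑ t ∈ Finset.Ico s T, (φ t - φ (t + 1)) = φ s - φ T := by
      have := Finset.sum_Ico_sub φ hsT
      rw [← neg_inj, ← Finset.sum_neg_distrib]
      simpa using this
    have h0 : φ s ≤ 2 := dotProduct_self_sub_le_two (gradientDescent_mem γ g s) (hu s)
    have h1 : 0 ≤ φ T := Finset.sum_nonneg fun i _ => mul_self_nonneg _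
    rw [Finset.sum_add_distrib, Finset.sum_add_distrib, htel, ← Finset.mul_sum,
      ← Finset.mul_sum, ← Finset.mul_sum, ← Finset.mul_sum] at h
    linarith
  have hsub : Finset.Ico s T ⊆ Finset.range T := fun t ht =>
    Finset.mem_range.2 (Finset.mem_Ico.1 ht).2
  have hp : ∑ t ∈ Finset.Ico s T, l1norm (u t - u (t + 1))
      ≤ ∑ t ∈ Finset.range T, l1norm (u t - u (t + 1)) :=
    Finset.sum_le_sum_of_subset_of_nonneg hsub fun _ _ _ => l1norm_nonneg _
  have hV : ∑ t ∈ Finset.Ico s T, ‖g t‖ ^ 2 ≤ ∑ t ∈ Finset.range T, ‖g t‖ ^ 2 :=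
    Finset.sum_le_sum_of_subset_of_nonneg hsub fun _ _ _ => sq_nonneg _
  have hV' := mul_le_mul_of_nonneg_left (mul_le_mul_of_nonneg_left hV
    (Nat.cast_nonneg (α := ℝ) (Fintype.card ι))) (sq_nonneg γ)
  rw [div_add_div _ _ hγ.ne' two_ne_zero, le_div_iff₀ (by positivity)]
  nlinarith

end GradientDescent

/-! ### Aggregating countably many experts -/

section Experts

variable {ι : Type*} [Fintype ι]

theorem exp_sub_two_mul_sq_le {y : ℝ} (hy : |y| ≤ 1 / 5) :
    Real.exp (y - 2 * y ^ 2) ≤ 1 + y := by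
  rw [abs_le] at hy
  have hz : |y - 2 * y ^ 2| ≤ 1 := by
    rw [abs_le]
    constructor <;> nlinarith
  have h := (abs_le.1 (Real.abs_exp_sub_one_sub_id_le hz)).2
  have h2 : (y - 2 * y ^ 2) ^ 2 ≤ 2 * y ^ 2 := by
    have e : (y - 2 * y ^ 2) ^ 2 = y ^ 2 * (1 - 2 * y) ^ 2 := by ring
    rw [e, mul_comm (2 : ℝ) (y ^ 2)]
    refine mul_le_mul_of_nonneg_left ?_ (sq_nonneg y)
    nlinarith
  linarith

/-- The action in round `t` of the aggregation of the experts `0, …, t`, where expert `i` plays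
`x i`, has prior weight `2^{-(i+1)}`, learning rate `η i` and log-weight `ℓ i`. Experts join one
per round, so that only finitely many are ever averaged. -/
noncomputable def expertMean (η ℓ : ℕ → ℝ) (x : ℕ → ι → ℝ) (t : ℕ) : ι → ℝ :=
  (Finset.range (t + 1)).centerMass (fun i => (1 / 2) ^ (i + 1) * η i * Real.exp (ℓ i)) x

/-- The log-weight of each expert after `t` rounds against the losses `g`, where expert `i` plays
`x t i` in round `t`: it accumulates `y - 2 y²`, where `y` is `η i` times the instantaneous regret
with respect to expert `i`, from round `i` on. -/
noncomputable def expertLogWeight (η : ℕ → ℝ) (x : ℕ → ℕ → ι → ℝ) (g : ℕ → ι → ℝ) :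
    ℕ → ℕ → ℝ
  | 0 => fun _ => 0
  | t + 1 => fun i =>
      expertLogWeight η x g t i +
        if i ≤ t then
          η i * (g t ⬝ᵥ (expertMean η (expertLogWeight η x g t) (x t) t - x t i))
            - 2 * (η i * (g t ⬝ᵥ (expertMean η (expertLogWeight η x g t) (x t) t - x t i))) ^ 2
        else 0

/-- The action of the aggregated algorithm in round `t`. -/
noncomputable def aggregate (η : ℕ → ℝ) (x : ℕ → ℕ → ι → ℝ) (g : ℕ → ι → ℝ) (t : ℕ) : ι → ℝ :=
  expertMean η (expertLogWeight η x g t) (x t) t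

theorem expertLogWeight_succ (η : ℕ → ℝ) (x : ℕ → ℕ → ι → ℝ) (g : ℕ → ι → ℝ) (t i : ℕ) :
    expertLogWeight η x g (t + 1) i = expertLogWeight η x g t i +
      if i ≤ t then η i * (g t ⬝ᵥ (aggregate η x g t - x t i))
        - 2 * (η i * (g t ⬝ᵥ (aggregate η x g t - x t i))) ^ 2 else 0 :=
  rfl

theorem expertLogWeight_congr (η : ℕ → ℝ) {x x' : ℕ → ℕ → ι → ℝ} {g g' : ℕ → ι → ℝ} {t : ℕ}
    (hx : ∀ s < t, x s = x' s) (hg : ∀ s < t, g s = g' s) :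
    expertLogWeight η x g t = expertLogWeight η x' g' t := by
  induction t with
  | zero => rfl
  | succ t ih =>
    rw [expertLogWeight, expertLogWeight,
      ih (fun s hs => hx s (hs.trans t.lt_succ_self)) (fun s hs => hg s (hs.trans t.lt_succ_self)),
      hx t t.lt_succ_self, hg t t.lt_succ_self]

theorem aggregate_congr (η : ℕ → ℝ) {x x' : ℕ → ℕ → ι → ℝ} {g g' : ℕ → ι → ℝ} {t : ℕ}
    (hx : ∀ s ≤ t, x s = x' s) (hg : ∀ s < t, g s = g' s) :
    aggregate η x g t = aggregate η x' g' t := by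
  rw [aggregate, aggregate, expertLogWeight_congr η (fun s hs => hx s hs.le) hg, hx t le_rfl]

theorem aggregate_mem {η : ℕ → ℝ} (hη : ∀ i, 0 < η i) {x : ℕ → ℕ → ι → ℝ}
    (hx : ∀ t i, x t i ∈ stdSimplex ℝ ι) (g : ℕ → ι → ℝ) (t : ℕ) :
    aggregate η x g t ∈ stdSimplex ℝ ι := by
  refine (convex_stdSimplex ℝ ι).centerMass_mem (fun i _ => ?_) ?_ fun i _ => hx t i
  · have := hη i
    positivity
  · refine Finset.sum_pos (fun i _ => ?_) ⟨0, by simp⟩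
    have := hη i
    positivity

theorem measurable_expertMean {Ω : Type*} [MeasurableSpace Ω] {η : ℕ → ℝ} {ℓ : Ω → ℕ → ℝ}
    {x : Ω → ℕ → ι → ℝ} (t : ℕ) (hℓ : ∀ i, Measurable fun ω => ℓ ω i)
    (hx : ∀ i, Measurable fun ω => x ω i) :
    Measurable fun ω => expertMean η (ℓ ω) (x ω) t := by
  unfold expertMean Finset.centerMass
  have h1 : Measurable fun ω => ∑ i ∈ Finset.range (t + 1),
      (1 / 2) ^ (i + 1) * η i * Real.exp (ℓ ω i) :=
    Finset.measurable_fun_sum _ fun i _ => ((hℓ i).exp).const_mul _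
  exact h1.inv.smul
    (Finset.measurable_fun_sum _ fun i _ => (((hℓ i).exp).const_mul _).smul (hx i))

theorem Measurable.dotProduct_pi {Ω : Type*} [MeasurableSpace Ω] {f g : Ω → ι → ℝ}
    (hf : Measurable f) (hg : Measurable g) : Measurable fun ω => f ω ⬝ᵥ g ω :=
  Finset.measurable_fun_sum _ fun i _ =>
    ((measurable_pi_apply i).comp hf).mul ((measurable_pi_apply i).comp hg)

theorem measurable_expertLogWeight {η : ℕ → ℝ} {x : (ℕ → ι → ℝ) → ℕ → ℕ → ι → ℝ}
    (hx : ∀ t i, Measurable fun g => x g t i) (t i : ℕ) :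
    Measurable fun g : ℕ → ι → ℝ => expertLogWeight η (x g) g t i := by
  induction t generalizing i with
  | zero => exact measurable_const
  | succ t ih =>
    simp only [expertLogWeight]
    have hy : Measurable fun g : ℕ → ι → ℝ =>
        η i * (g t ⬝ᵥ (expertMean η (expertLogWeight η (x g) g t) (x g t) t - x g t i)) :=
      ((measurable_pi_apply t).dotProduct_pi
        ((measurable_expertMean t ih (hx t)).sub (hx t i))).const_mul _
    refine (ih i).add ?_
    split_ifs
    · exact hy.sub ((hy.pow_const 2).const_mul 2)
    · exact measurable_const

theorem measurable_aggregate {η : ℕ → ℝ} {x : (ℕ → ι → ℝ) → ℕ → ℕ → ι → ℝ}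
    (hx : ∀ t i, Measurable fun g => x g t i) (t : ℕ) :
    Measurable fun g : ℕ → ι → ℝ => aggregate η (x g) g t :=
  measurable_expertMean t (measurable_expertLogWeight hx t) (hx t)

theorem expertLogWeight_of_le (η : ℕ → ℝ) (x : ℕ → ℕ → ι → ℝ) (g : ℕ → ι → ℝ) {t i : ℕ}
    (hti : t ≤ i) : expertLogWeight η x g t i = 0 := by
  induction t with
  | zero => rfl
  | succ t ih => rw [expertLogWeight_succ, ih (by omega), if_neg (by omega), add_zero]

theorem expertLogWeight_eq_sum (η : ℕ → ℝ) (x : ℕ → ℕ → ι → ℝ) (g : ℕ → ι → ℝ) {T i : ℕ}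
    (hiT : i ≤ T) : expertLogWeight η x g T i = ∑ t ∈ Finset.Ico i T,
      (η i * (g t ⬝ᵥ (aggregate η x g t - x t i))
        - 2 * (η i * (g t ⬝ᵥ (aggregate η x g t - x t i))) ^ 2) := by
  induction T, hiT using Nat.le_induction with
  | base => rw [expertLogWeight_of_le η x g le_rfl, Finset.Ico_self, Finset.sum_empty]
  | succ T hiT ih => rw [Finset.sum_Ico_succ_top hiT, ← ih, expertLogWeight_succ, if_pos hiT]

/-- The weighted mean is chosen so that the weighted instantaneous regrets cancel. -/
theorem sum_weight_mul_aggregate_sub {η : ℕ → ℝ} (hη : ∀ i, 0 < η i) (x : ℕ → ℕ → ι → ℝ)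
    (g : ℕ → ι → ℝ) (t : ℕ) :
    ∑ i ∈ Finset.range (t + 1), (1 / 2) ^ (i + 1) * η i * Real.exp (expertLogWeight η x g t i) *
      (g t ⬝ᵥ (aggregate η x g t - x t i)) = 0 := by
  set c : ℕ → ℝ := fun i => (1 / 2) ^ (i + 1) * η i * Real.exp (expertLogWeight η x g t i)
    with hc
  have hpos : 0 < ∑ i ∈ Finset.range (t + 1), c i := by
    refine Finset.sum_pos (fun i _ => ?_) ⟨0, by simp⟩
    have := hη i
    positivity
  have hmean : (∑ i ∈ Finset.range (t + 1), c i) • aggregate η x g t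
      = ∑ i ∈ Finset.range (t + 1), c i • x t i := by
    rw [aggregate, expertMean, Finset.centerMass, smul_smul, mul_inv_cancel₀ hpos.ne', one_smul]
  calc ∑ i ∈ Finset.range (t + 1), c i * (g t ⬝ᵥ (aggregate η x g t - x t i))
      = g t ⬝ᵥ ((∑ i ∈ Finset.range (t + 1), c i) • aggregate η x g t
          - ∑ i ∈ Finset.range (t + 1), c i • x t i) := by
        rw [dotProduct_sub, dotProduct_smul, dotProduct_sum, smul_eq_mul, Finset.sum_mul,
          ← Finset.sum_sub_distrib]
        refine Finset.sum_congr rfl fun i _ => ?_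
        rw [dotProduct_sub, dotProduct_smul, smul_eq_mul]
        ring
    _ = 0 := by rw [hmean, sub_self, dotProduct_zero]

/-- The total weight of the experts which have joined never exceeds their prior weight. -/
theorem sum_exp_expertLogWeight_le {η : ℕ → ℝ} (hη : ∀ i, 0 < η i) (hη' : ∀ i, η i ≤ 1 / 10)
    {x : ℕ → ℕ → ι → ℝ} (hx : ∀ t i, x t i ∈ stdSimplex ℝ ι) (g : ℕ → ι → ℝ) (T : ℕ)
    (hg : ∀ t < T, ‖g t‖ ≤ 1) :
    ∑ i ∈ Finset.range T, (1 / 2 : ℝ) ^ (i + 1) * Real.exp (expertLogWeight η x g T i)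
      ≤ ∑ i ∈ Finset.range T, (1 / 2 : ℝ) ^ (i + 1) := by
  induction T with
  | zero => simp
  | succ T ih =>
    calc ∑ i ∈ Finset.range (T + 1),
          (1 / 2 : ℝ) ^ (i + 1) * Real.exp (expertLogWeight η x g (T + 1) i)
        ≤ ∑ i ∈ Finset.range (T + 1),
          ((1 / 2 : ℝ) ^ (i + 1) * Real.exp (expertLogWeight η x g T i)
            + (1 / 2) ^ (i + 1) * η i * Real.exp (expertLogWeight η x g T i) *
              (g T ⬝ᵥ (aggregate η x g T - x T i))) := by
          refine Finset.sum_le_sum fun i hi => ?_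
          rw [expertLogWeight_succ, if_pos (Nat.lt_succ_iff.1 (Finset.mem_range.1 hi)),
            Real.exp_add]
          have hy : |η i * (g T ⬝ᵥ (aggregate η x g T - x T i))| ≤ 1 / 5 := by
            have h1 := abs_dotProduct_le_norm_mul_l1norm (g T) (aggregate η x g T - x T i)
            have h2 := l1norm_sub_le_two (aggregate_mem hη hx g T) (hx T i)
            have h3 := hg T T.lt_succ_self
            have h4 := l1norm_nonneg (aggregate η x g T - x T i)
            have h5 := hη i
            have h6 := hη' i
            rw [abs_mul, abs_of_pos h5]
            have h7 : |g T ⬝ᵥ (aggregate η x g T - x T i)| ≤ 2 := by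
              nlinarith [norm_nonneg (g T)]
            nlinarith [abs_nonneg (g T ⬝ᵥ (aggregate η x g T - x T i))]
          have h := exp_sub_two_mul_sq_le hy
          have hw : 0 ≤ (1 / 2 : ℝ) ^ (i + 1) * Real.exp (expertLogWeight η x g T i) := by
            positivity
          have := mul_le_mul_of_nonneg_left h hw
          linarith
      _ = ∑ i ∈ Finset.range (T + 1),
          (1 / 2 : ℝ) ^ (i + 1) * Real.exp (expertLogWeight η x g T i) := by
          rw [Finset.sum_add_distrib, sum_weight_mul_aggregate_sub hη, add_zero]
      _ ≤ _ := by
          rw [Finset.sum_range_succ, Finset.sum_range_succ, expertLogWeight_of_le η x g le_rfl,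
            Real.exp_zero, mul_one]
          exact add_le_add_left (ih fun t ht => hg t (ht.trans T.lt_succ_self)) _

theorem aggregate_regret {η : ℕ → ℝ} (hη : ∀ i, 0 < η i) (hη' : ∀ i, η i ≤ 1 / 10)
    {x : ℕ → ℕ → ι → ℝ} (hx : ∀ t i, x t i ∈ stdSimplex ℝ ι) (g : ℕ → ι → ℝ) {T i : ℕ}
    (hg : ∀ t < T, ‖g t‖ ≤ 1) (hiT : i < T) :
    ∑ t ∈ Finset.Ico i T, g t ⬝ᵥ (aggregate η x g t - x t i)
      ≤ (i + 1) / η i + 8 * η i * ∑ t ∈ Finset.range T, ‖g t‖ ^ 2 := by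
  have hpot := sum_exp_expertLogWeight_le hη hη' hx g T hg
  have hgeom : ∑ i ∈ Finset.range T, (1 / 2 : ℝ) ^ (i + 1) ≤ 1 := by
    have h := geom_sum_eq (x := (1 / 2 : ℝ)) (by norm_num) T
    simp only [pow_succ]
    rw [← Finset.sum_mul, h]
    have : 0 < (1 / 2 : ℝ) ^ T := by positivity
    have e : ((1 / 2 : ℝ) ^ T - 1) / (1 / 2 - 1) * (1 / 2) = 1 - (1 / 2) ^ T := by ring
    linarith
  have hone : (1 / 2 : ℝ) ^ (i + 1) * Real.exp (expertLogWeight η x g T i) ≤ 1 := by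
    refine le_trans ?_ (hpot.trans hgeom)
    exact Finset.single_le_sum
      (f := fun i => (1 / 2 : ℝ) ^ (i + 1) * Real.exp (expertLogWeight η x g T i))
      (fun j _ => by positivity) (Finset.mem_range.2 hiT)
  have hlog : expertLogWeight η x g T i ≤ i + 1 := by
    have h1 : Real.exp (expertLogWeight η x g T i) ≤ 2 ^ (i + 1) := by
      rw [one_div, inv_pow, inv_mul_le_iff₀ (by positivity), mul_one] at hone
      exact hone
    have h2 : (2 : ℝ) ^ (i + 1) ≤ Real.exp (i + 1) := by
      have := pow_le_pow_left₀ (by norm_num) (Real.add_one_le_exp (1 : ℝ)) (i + 1)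
      rw [← Real.exp_nat_mul] at this
      push_cast at this
      norm_num at this
      exact this
    exact Real.exp_le_exp.1 (h1.trans h2)
  rw [expertLogWeight_eq_sum η x g hiT.le, Finset.sum_sub_distrib, ← Finset.mul_sum,
    ← Finset.mul_sum] at hlog
  have hsq : ∑ t ∈ Finset.Ico i T, (η i * (g t ⬝ᵥ (aggregate η x g t - x t i))) ^ 2
      ≤ η i ^ 2 * (4 * ∑ t ∈ Finset.range T, ‖g t‖ ^ 2) := by
    calc ∑ t ∈ Finset.Ico i T, (η i * (g t ⬝ᵥ (aggregate η x g t - x t i))) ^ 2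
        ≤ ∑ t ∈ Finset.Ico i T, η i ^ 2 * (4 * ‖g t‖ ^ 2) := by
          refine Finset.sum_le_sum fun t _ => ?_
          rw [mul_pow]
          refine mul_le_mul_of_nonneg_left ?_ (sq_nonneg _)
          have h1 := abs_dotProduct_le_norm_mul_l1norm (g t) (aggregate η x g t - x t i)
          have h2 := l1norm_sub_le_two (aggregate_mem hη hx g t) (hx t i)
          have h3 : |g t ⬝ᵥ (aggregate η x g t - x t i)| ≤ 2 * ‖g t‖ :=
            h1.trans (by nlinarith [norm_nonneg (g t)])
          have h4 := pow_le_pow_left₀ (abs_nonneg _) h3 2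
          rw [sq_abs] at h4
          linarith
      _ ≤ ∑ t ∈ Finset.range T, η i ^ 2 * (4 * ‖g t‖ ^ 2) :=
          Finset.sum_le_sum_of_subset_of_nonneg
            (fun t ht => Finset.mem_range.2 (Finset.mem_Ico.1 ht).2)
            fun _ _ _ => by positivity
      _ = _ := by rw [← Finset.mul_sum, ← Finset.mul_sum]
  have hi := hη i
  rw [← sub_le_iff_le_add, le_div_iff₀ hi]
  nlinarith

end Experts

/-! ### A parameter-free algorithm on the simplex -/

section ParameterFree

/-- An enumeration of the step sizes `2^j`, `j ∈ ℤ`: the values at `2 j` and `2 j + 1` are `2^j`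
and `2^{-j}`. -/
noncomputable def gridStep (i : ℕ) : ℝ :=
  if Even i then 2 ^ (i / 2) else (2 ^ (i / 2))⁻¹

/-- The learning rate at which the expert with step size `gridStep i` is aggregated. It is
proportional to the step size as long as that is compatible with the upper bound `1 / 10`. -/
noncomputable def gridRate (i : ℕ) : ℝ := min (gridStep i) 1 / 10

theorem gridStep_pos (i : ℕ) : 0 < gridStep i := by
  unfold gridStep
  split_ifs <;> positivity

theorem gridRate_pos (i : ℕ) : 0 < gridRate i :=
  div_pos (lt_min (gridStep_pos i) one_pos) (by norm_num)

theorem gridRate_le (i : ℕ) : gridRate i ≤ 1 / 10 :=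
  div_le_div_of_nonneg_right (min_le_right _ _) (by norm_num)

/-- Every `y ≥ 1` is within a factor `2` of a power `2^j` with `j ≤ 2 log y`. -/
theorem exists_pow_two_near {y : ℝ} (hy : 1 ≤ y) :
    ∃ j : ℕ, y / 2 ≤ 2 ^ j ∧ (2 : ℝ) ^ j ≤ y ∧ (j : ℝ) ≤ 2 * Real.log y := by
  obtain ⟨j, hj, hj'⟩ := exists_nat_pow_near hy one_lt_two
  refine ⟨j, ?_, hj, ?_⟩
  · rw [pow_succ] at hj'
    linarith
  · have h := Real.log_le_log (by positivity) hj
    rw [Real.log_pow] at h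
    have := Real.log_two_gt_d9
    nlinarith [Nat.cast_nonneg (α := ℝ) j]

/-- Some grid step is within a factor `2` of `y`, and its index is logarithmic in `y`. -/
theorem exists_gridStep_near {y L : ℝ} (hy : 0 < y) (hL : Real.log y ≤ L)
    (hL' : -L ≤ Real.log y) :
    ∃ i : ℕ, y / 2 ≤ gridStep i ∧ gridStep i ≤ 2 * y ∧ (i : ℝ) ≤ 4 * L + 1 := by
  rcases le_total 1 y with h1 | h1
  · obtain ⟨j, hj1, hj2, hj3⟩ := exists_pow_two_near h1
    refine ⟨2 * j, ?_⟩
    rw [gridStep, if_pos (even_two_mul j), Nat.mul_div_cancel_left j two_pos]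
    push_cast
    exact ⟨hj1, by linarith, by linarith⟩
  · obtain ⟨j, hj1, hj2, hj3⟩ := exists_pow_two_near ((one_le_inv₀ hy).2 h1)
    refine ⟨2 * j + 1, ?_⟩
    have he : ¬ Even (2 * j + 1) := by simp
    rw [gridStep, if_neg he, show (2 * j + 1) / 2 = j by omega]
    push_cast
    rw [Real.log_inv] at hj3
    have hp : (0 : ℝ) < 2 ^ j := by positivity
    refine ⟨?_, ?_, by linarith⟩
    · have := inv_anti₀ hp hj2
      rw [inv_inv] at this
      linarith
    · have := inv_anti₀ (by positivity) hj1
      rw [inv_div, div_inv_eq_mul] at this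
      exact this

variable {ι : Type*} [Fintype ι]

/-- The action in round `t`, against the losses `g`, of the aggregation of gradient descent over
the grid of step sizes. -/
noncomputable def gridDescent (g : ℕ → ι → ℝ) (t : ℕ) : ι → ℝ :=
  aggregate gridRate (fun t i => gradientDescent (gridStep i) g t) g t

theorem gridDescent_congr {g g' : ℕ → ι → ℝ} {t : ℕ} (h : ∀ s < t, g s = g' s) :
    gridDescent g t = gridDescent g' t :=
  aggregate_congr gridRate
    (fun _ hs => funext fun _ => gradientDescent_congr _ fun r hr => h r (hr.trans_le hs)) h

/-- `gridDescent` as an algorithm which is given finitely many losses: they are extended by `0`,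
which is immaterial by `gridDescent_congr`. -/
noncomputable def gridDescentAlgorithm (ι : Type*) [Fintype ι] [Nonempty ι] :
    OLOAlgorithm (stdSimplex ℝ ι) where
  play n h := gridDescent (fun s => if hs : s < n then h ⟨s, hs⟩ else 0) n
  play_mem n h := aggregate_mem gridRate_pos (fun _ _ => gradientDescent_mem _ _ _) _ _
  measurable_play n := by
    refine (measurable_aggregate (fun t i => measurable_gradientDescent _ t) n).comp
      (measurable_pi_lambda _ fun s => ?_)
    by_cases hs : s < n
    · simpa only [hs, dif_pos] using measurable_pi_apply _
    · simpa only [hs, dif_neg, not_false_eq_true] using measurable_const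

theorem sum_dotProduct_le_two_mul {x u : ℕ → ι → ℝ} (hx : ∀ t, x t ∈ stdSimplex ℝ ι)
    (hu : ∀ t, u t ∈ stdSimplex ℝ ι) (g : ℕ → ι → ℝ) (s : Finset ℕ) :
    ∑ t ∈ s, g t ⬝ᵥ (x t - u t) ≤ 2 * ∑ t ∈ s, ‖g t‖ := by
  rw [Finset.mul_sum]
  refine Finset.sum_le_sum fun t _ => (dotProduct_le_norm_mul_l1norm _ _).trans ?_
  rw [mul_comm]
  exact mul_le_mul_of_nonneg_right (l1norm_sub_le_two (hx t) (hu t)) (norm_nonneg _)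

variable [Nonempty ι]

theorem gridDescentAlgorithm_action (g : ℕ → ι → ℝ) (t : ℕ) :
    (gridDescentAlgorithm ι).action g t = gridDescent g t :=
  gridDescent_congr fun s hs => by simp [hs]

theorem gridDescent_mem (g : ℕ → ι → ℝ) (t : ℕ) : gridDescent g t ∈ stdSimplex ℝ ι :=
  aggregate_mem gridRate_pos (fun _ _ => gradientDescent_mem _ _ _) _ _

/-- The regret of the aggregation in terms of any single step size of the grid. Expert `i` only
joins in round `i`, and every earlier round costs at most `2`. -/
theorem gridDescent_regret_le {g u : ℕ → ι → ℝ} {T : ℕ} (hg : ∀ t < T, ‖g t‖ ≤ 1)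
    (hu : ∀ t, u t ∈ stdSimplex ℝ ι) (i : ℕ) :
    ∑ t ∈ Finset.range T, g t ⬝ᵥ (gridDescent g t - u t) ≤
      2 * i + 10 * (i + 1) * ((gridStep i)⁻¹ + 1)
        + gridStep i * ∑ t ∈ Finset.range T, ‖g t‖ ^ 2
        + ((1 + ∑ t ∈ Finset.range T, l1norm (u t - u (t + 1))) / gridStep i
        + gridStep i * (Fintype.card ι * ∑ t ∈ Finset.range T, ‖g t‖ ^ 2) / 2) := by
  have hγ := gridStep_pos i
  set V := ∑ t ∈ Finset.range T, ‖g t‖ ^ 2 with hV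
  have hV0 : 0 ≤ V := Finset.sum_nonneg fun _ _ => sq_nonneg _
  have hP0 : 0 ≤ ∑ t ∈ Finset.range T, l1norm (u t - u (t + 1)) :=
    Finset.sum_nonneg fun _ _ => l1norm_nonneg _
  have hsum : ∀ n ≤ T, ∑ t ∈ Finset.range n, ‖g t‖ ≤ n := by
    intro n hn
    calc ∑ t ∈ Finset.range n, ‖g t‖ ≤ ∑ _t ∈ Finset.range n, (1 : ℝ) :=
          Finset.sum_le_sum fun t ht => hg t ((Finset.mem_range.1 ht).trans_le hn)
      _ = n := by simp
  rcases le_or_gt T i with hTi | hiT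
  · have h1 := sum_dotProduct_le_two_mul (gridDescent_mem g) hu g (Finset.range T)
    have h2 := hsum T le_rfl
    have h3 : (T : ℝ) ≤ i := by exact_mod_cast hTi
    have h4 : 0 ≤ 10 * ((i : ℝ) + 1) * ((gridStep i)⁻¹ + 1) + gridStep i * V
        + ((1 + ∑ t ∈ Finset.range T, l1norm (u t - u (t + 1))) / gridStep i
        + gridStep i * (Fintype.card ι * V) / 2) := by positivity
    linarith
  · have h1 := sum_dotProduct_le_two_mul (gridDescent_mem g) hu g (Finset.range i)
    have h2 := hsum i hiT.le
    have h3 := aggregate_regret gridRate_pos gridRate_le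
      (x := fun t i => gradientDescent (gridStep i) g t)
      (fun _ _ => gradientDescent_mem _ _ _) g hg hiT
    have h4 := gradientDescent_regret hγ g u hu hiT.le
    have h5 : ((i : ℝ) + 1) / gridRate i ≤ 10 * (i + 1) * ((gridStep i)⁻¹ + 1) := by
      rw [gridRate, div_div_eq_mul_div, mul_comm _ (10 : ℝ), div_eq_mul_inv]
      refine mul_le_mul_of_nonneg_left ?_ (by positivity)
      rcases min_choice (gridStep i) 1 with h | h <;> rw [h]
      · linarith
      · have : 0 < (gridStep i)⁻¹ := by positivity
        norm_num
        exact hγ.le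
    have h6 : 8 * gridRate i * V ≤ gridStep i * V := by
      refine mul_le_mul_of_nonneg_right ?_ hV0
      have := min_le_left (gridStep i) 1
      rw [gridRate]
      linarith
    rw [← Finset.sum_range_add_sum_Ico _ hiT.le]
    have h7 : ∑ t ∈ Finset.Ico i T, g t ⬝ᵥ (gridDescent g t - u t)
        = ∑ t ∈ Finset.Ico i T, g t ⬝ᵥ (gridDescent g t - gradientDescent (gridStep i) g t)
          + ∑ t ∈ Finset.Ico i T, g t ⬝ᵥ (gradientDescent (gridStep i) g t - u t) := by
      rw [← Finset.sum_add_distrib]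
      refine Finset.sum_congr rfl fun t _ => ?_
      rw [← dotProduct_add, sub_add_sub_cancel]
    rw [h7]
    unfold gridDescent at *
    linarith

/-- Choosing the step size close to `√((1 + P) / (1 + V))`, for the path length `P` and the sum
`V` of the squared loss norms. When `1 + P` exceeds `2 + T V` the bound is trivial; otherwise the
index of this step size is of order `log (2 + T V)`. -/
theorem gridDescent_regret {g u : ℕ → ι → ℝ} {T : ℕ} (hT : 0 < T) (hg : ∀ t < T, ‖g t‖ ≤ 1)
    (hu : ∀ t, u t ∈ stdSimplex ℝ ι) :
    ∑ t ∈ Finset.range T, g t ⬝ᵥ (gridDescent g t - u t) ≤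
      (400 + 2 * Fintype.card ι) * √(1 + ∑ t ∈ Finset.range T, l1norm (u t - u (t + 1))) *
        √(1 + ∑ t ∈ Finset.range T, ‖g t‖ ^ 2) *
        Real.log (2 + T * ∑ t ∈ Finset.range T, ‖g t‖ ^ 2) := by
  set V := ∑ t ∈ Finset.range T, ‖g t‖ ^ 2 with hV
  set P := ∑ t ∈ Finset.range T, l1norm (u t - u (t + 1)) with hP
  have hV0 : 0 ≤ V := Finset.sum_nonneg fun _ _ => sq_nonneg _
  have hP0 : 0 ≤ P := Finset.sum_nonneg fun _ _ => l1norm_nonneg _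
  have hT1 : (1 : ℝ) ≤ T := by exact_mod_cast hT
  have hTV : 0 ≤ T * V := by positivity
  set Λ := Real.log (2 + T * V) with hΛ
  have hΛ2 : 1 / 2 ≤ Λ := by
    have h1 := Real.log_two_gt_d9
    have h2 := Real.log_le_log two_pos (show (2 : ℝ) ≤ 2 + T * V by linarith)
    linarith
  set p := √(1 + P) with hp
  set v := √(1 + V) with hv
  have hp1 : 1 ≤ p := Real.one_le_sqrt.2 (by linarith)
  have hv1 : 1 ≤ v := Real.one_le_sqrt.2 (by linarith)
  have hp2 : p ^ 2 = 1 + P := Real.sq_sqrt (by linarith)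
  have hv2 : v ^ 2 = 1 + V := Real.sq_sqrt (by linarith)
  have hpv : 1 ≤ p * v := one_le_mul_of_one_le_of_one_le hp1 hv1
  have hN : (0 : ℝ) ≤ Fintype.card ι := Nat.cast_nonneg _
  rcases lt_or_ge (2 + T * V) (1 + P) with hlarge | hsmall
  · have h1 := sum_dotProduct_le_two_mul (gridDescent_mem g) hu g (Finset.range T)
    have h2 : (∑ t ∈ Finset.range T, ‖g t‖) ^ 2 ≤ T * V := by
      have := sq_sum_le_card_mul_sum_sq (s := Finset.range T) (f := fun t => ‖g t‖)
      rwa [Finset.card_range] at this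
    have h3 : ∑ t ∈ Finset.range T, ‖g t‖ ≤ p := Real.le_sqrt_of_sq_le (by linarith)
    have h4 : p ≤ p * v := le_mul_of_one_le_right (by linarith) hv1
    have h5 : p * v ≤ 2 * (p * v * Λ) := by nlinarith
    nlinarith
  · have hlogp : Real.log (1 + P) ≤ Λ := Real.log_le_log (by linarith) hsmall
    have hlogv : Real.log (1 + V) ≤ Λ :=
      Real.log_le_log (by linarith) (by nlinarith)
    have hlogp0 : 0 ≤ Real.log (1 + P) := Real.log_nonneg (by linarith)
    have hlogv0 : 0 ≤ Real.log (1 + V) := Real.log_nonneg (by linarith)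
    have hlog : Real.log (p / v) = Real.log (1 + P) / 2 - Real.log (1 + V) / 2 := by
      rw [Real.log_div (by linarith) (by linarith), hp, hv, Real.log_sqrt (by linarith),
        Real.log_sqrt (by linarith)]
    obtain ⟨i, hi1, hi2, hi3⟩ := exists_gridStep_near (y := p / v) (L := Λ / 2) (by positivity)
      (by linarith) (by linarith)
    have h := gridDescent_regret_le hg hu i
    have hγ := gridStep_pos i
    set γ := gridStep i with hγdef
    have hpos : 0 < p := by linarith
    have hvpos : 0 < v := by linarith
    have hinv : γ⁻¹ ≤ 2 * (v / p) := by
      have := inv_anti₀ (by positivity) hi1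
      refine this.trans_eq ?_
      field_simp
    have e1 : γ⁻¹ ≤ 2 * (p * v) := by
      refine hinv.trans ?_
      have : v / p ≤ p * v := by
        rw [div_le_iff₀ hpos]
        nlinarith [mul_pos hpos hvpos]
      linarith
    have e2 : (1 + P) / γ ≤ 2 * (p * v) := by
      rw [div_eq_mul_inv, ← hp2]
      calc p ^ 2 * γ⁻¹ ≤ p ^ 2 * (2 * (v / p)) := by gcongr
        _ = 2 * (p * v) := by field_simp
    have e3 : γ * V ≤ 2 * (p * v) := by
      calc γ * V ≤ 2 * (p / v) * v ^ 2 := by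
            rw [hv2]
            exact mul_le_mul hi2 (by linarith) hV0 (by positivity)
        _ = 2 * (p * v) := by field_simp
    have e4 : γ * (Fintype.card ι * V) / 2 ≤ Fintype.card ι * (p * v) := by
      have := mul_le_mul_of_nonneg_left e3 hN
      linarith
    have e5 : (i : ℝ) + 1 ≤ 6 * Λ := by linarith
    have e6 : 10 * ((i : ℝ) + 1) * (γ⁻¹ + 1) ≤ 10 * (6 * Λ) * (3 * (p * v)) := by
      have h1 : γ⁻¹ + 1 ≤ 3 * (p * v) := by linarith
      have h2 : 0 ≤ γ⁻¹ + 1 := by positivity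
      exact mul_le_mul (by linarith) h1 h2 (by linarith)
    have e7 : 2 * (i : ℝ) ≤ 12 * Λ * (p * v) := by
      have : 12 * Λ * 1 ≤ 12 * Λ * (p * v) := mul_le_mul_of_nonneg_left hpv (by linarith)
      linarith
    have e8 : (4 + Fintype.card ι) * (p * v) ≤ (4 + Fintype.card ι) * (p * v) * (2 * Λ) :=
      le_mul_of_one_le_right (by positivity) (by linarith)
    have e9 : 0 ≤ p * v * Λ := by positivity
    have hfinal : (400 + 2 * (Fintype.card ι : ℝ)) * p * v * Λ
      = 200 * (p * v * Λ) + 12 * Λ * (p * v) + 10 * (6 * Λ) * (3 * (p * v))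
        + (4 + Fintype.card ι) * (p * v) * (2 * Λ) := by ring
    rw [hfinal]
    linarith only [h, e1, e2, e3, e4, e6, e7, e8, e9]

theorem isPFOL_gridDescentAlgorithm :
    IsPFOL (gridDescentAlgorithm ι) (400 + 2 * Fintype.card ι) := by
  intro T g u hg hu
  rw [dynamicRegret]
  simp only [gridDescentAlgorithm_action]
  rcases Nat.eq_zero_or_pos T with rfl | hT
  · simp only [Finset.range_zero, Finset.sum_empty]
    positivity
  have hlog : 0 ≤ Real.log (2 + T * ∑ t ∈ Finset.range T, ‖g t‖ ^ 2) := by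
    refine Real.log_nonneg ?_
    have : 0 ≤ (T : ℝ) * ∑ t ∈ Finset.range T, ‖g t‖ ^ 2 := by positivity
    linarith
  rcases subsingleton_or_nontrivial ι with hι | hι
  · -- The simplex is a point: its diameter is `0`, so that the regret has to be exactly `0`.
    have hzero : ∑ t ∈ Finset.range T, ∑ i, g t i * (gridDescent g t i - u t i) = 0 := by
      refine Finset.sum_eq_zero fun t ht => Finset.sum_eq_zero fun i _ => ?_
      have h1 := (gridDescent_mem g t).2
      have h2 := (hu t (Finset.mem_range.1 ht)).2
      rw [Fintype.sum_subsingleton _ i] at h1 h2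
      rw [h1, h2, sub_self, mul_zero]
    rw [hzero]
    exact mul_nonneg (by positivity) hlog
  · -- The comparators are extended beyond the horizon by their last value, which adds nothing to
    -- the path length.
    have hu' : ∀ t, u (min t (T - 1)) ∈ stdSimplex ℝ ι := fun t => hu _ (by omega)
    have h := gridDescent_regret hT hg hu'
    have e1 : ∑ t ∈ Finset.range T, g t ⬝ᵥ (gridDescent g t - u (min t (T - 1)))
        = ∑ t ∈ Finset.range T, ∑ i, g t i * (gridDescent g t i - u t i) := by
      refine Finset.sum_congr rfl fun t ht => ?_
      rw [min_eq_left (by have := Finset.mem_range.1 ht; omega)]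
      rfl
    have e2 : ∑ t ∈ Finset.range T, l1norm (u (min t (T - 1)) - u (min (t + 1) (T - 1)))
        = ∑ t ∈ Finset.range (T - 1), l1norm (u t - u (t + 1)) := by
      obtain ⟨n, rfl⟩ : ∃ n, T = n + 1 := ⟨T - 1, by omega⟩
      rw [Finset.sum_range_succ, Nat.add_sub_cancel, min_self, min_eq_right n.le_succ, sub_self]
      have h0 : l1norm (0 : ι → ℝ) = 0 := by simp [l1norm]
      rw [h0, add_zero]
      refine Finset.sum_congr rfl fun t ht => ?_
      have := Finset.mem_range.1 ht
      rw [min_eq_left (by omega), min_eq_left (by omega)]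
    rw [e1, e2] at h
    refine h.trans ?_
    have hP0 : 0 ≤ ∑ t ∈ Finset.range (T - 1), l1norm (u t - u (t + 1)) :=
      Finset.sum_nonneg fun _ _ => l1norm_nonneg _
    have hD := two_le_l1diam_stdSimplex (ι := ι)
    gcongr
    nlinarith

end ParameterFree

/-! ### Regret of AdaPFOL -/

section AdaPFOL

theorem one_le_adaPFOLState (Gmax : ℕ → ℝ) (t : ℕ) : 1 ≤ (adaPFOLState Gmax t).1 := by
  induction t with
  | zero =>
    rw [adaPFOLState]
    split_ifs <;> (try dsimp only) <;> linarith
  | succ t ih =>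
    rw [adaPFOLState]
    split_ifs <;> (try dsimp only) <;> linarith

theorem adaPFOLState_snd_le (Gmax : ℕ → ℝ) (t : ℕ) : (adaPFOLState Gmax t).2 ≤ t := by
  induction t with
  | zero =>
    rw [adaPFOLState]
    split_ifs <;> exact le_rfl
  | succ t ih =>
    rw [adaPFOLState]
    split_ifs <;> (try dsimp only) <;> omega

/-- Since the current instance was started, the state has not changed, and the scale has dominated
the magnitudes. -/
theorem adaPFOLState_eq_of_mem (Gmax : ℕ → ℝ) {t r : ℕ} (hr : (adaPFOLState Gmax t).2 ≤ r)
    (hrt : r ≤ t) :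
    adaPFOLState Gmax r = adaPFOLState Gmax t ∧ Gmax r ≤ (adaPFOLState Gmax t).1 := by
  induction t with
  | zero =>
    obtain rfl : r = 0 := by omega
    refine ⟨rfl, ?_⟩
    rw [adaPFOLState]
    split_ifs <;> (try dsimp only) <;> linarith
  | succ t ih =>
    have h1 := one_le_adaPFOLState Gmax t
    rw [adaPFOLState] at hr
    rcases hrt.eq_or_lt with rfl | hlt
    · refine ⟨rfl, ?_⟩
      rw [adaPFOLState]
      split_ifs <;> (try dsimp only) <;> linarith
    · rw [adaPFOLState]
      split_ifs at hr ⊢ with h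
      · dsimp only at hr
        omega
      · exact ih hr (by omega)

theorem adaPFOLState_fst_eq (Gmax : ℕ → ℝ) (t : ℕ) :
    (adaPFOLState Gmax t).1 = 1 ∨ ∃ r ≤ t, (adaPFOLState Gmax t).1 = 2 * Gmax r := by
  induction t with
  | zero =>
    rw [adaPFOLState]
    split_ifs
    · exact .inr ⟨0, le_rfl, rfl⟩
    · exact .inl rfl
  | succ t ih =>
    rw [adaPFOLState]
    split_ifs
    · exact .inr ⟨t + 1, le_rfl, rfl⟩
    · rcases ih with h | ⟨r, hr, h⟩
      · exact .inl h
      · exact .inr ⟨r, by omega, h⟩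

/-- The scale at least doubles at each restart. -/
theorem two_mul_adaPFOLState_le (Gmax : ℕ → ℝ) {s t : ℕ} (h : (adaPFOLState Gmax t).2 = s + 1) :
    2 * (adaPFOLState Gmax s).1 ≤ (adaPFOLState Gmax t).1 := by
  induction t with
  | zero =>
    have := adaPFOLState_snd_le Gmax 0
    omega
  | succ t ih =>
    rw [adaPFOLState] at h ⊢
    split_ifs at h ⊢ with hG
    · dsimp only at h ⊢
      obtain rfl : t = s := by omega
      linarith
    · exact ih h

variable {ι : Type*} [Fintype ι] {X : Set (ι → ℝ)}

theorem l1diam_nonneg (X : Set (ι → ℝ)) : 0 ≤ l1diam X := by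
  refine Real.sSup_nonneg ?_
  rintro d ⟨x, -, y, -, rfl⟩
  exact l1norm_nonneg _

theorem adaPFOL_eq_action (A : OLOAlgorithm X) (Gmax : ℕ → ℝ) (g : ℕ → ι → ℝ) (t : ℕ) :
    adaPFOL A Gmax g t = A.action
      (fun i => (adaPFOLState Gmax t).1⁻¹ • g ((adaPFOLState Gmax t).2 + i))
      (t - (adaPFOLState Gmax t).2) :=
  rfl

/-- The regret of AdaPFOL since its last restart. -/
theorem adaPFOL_regret_segment {A : OLOAlgorithm X} {K : ℝ} (hA : IsPFOL A K) {Gmax : ℕ → ℝ}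
    {g u : ℕ → ι → ℝ} {n T : ℕ} (hnT : n < T) (hg : ∀ t < T, ‖g t‖ ≤ Gmax t)
    (hu : ∀ t < T, u t ∈ X) :
    ∑ t ∈ Finset.Ico (adaPFOLState Gmax n).2 (n + 1), g t ⬝ᵥ (adaPFOL A Gmax g t - u t) ≤
      |K| * √(l1diam X * (l1diam X + ∑ t ∈ Finset.range (T - 1), l1norm (u t - u (t + 1)))) *
        Real.log (2 + (T : ℝ) ^ 2) *
        √((adaPFOLState Gmax n).1 * ((adaPFOLState Gmax n).1
          + ∑ t ∈ Finset.Ico (adaPFOLState Gmax n).2 (n + 1), ‖g t‖)) := by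
  have hsn := adaPFOLState_snd_le Gmax n
  have hG1 := one_le_adaPFOLState Gmax n
  have hst : ∀ r, (adaPFOLState Gmax n).2 ≤ r → r ≤ n →
      adaPFOLState Gmax r = adaPFOLState Gmax n ∧ Gmax r ≤ (adaPFOLState Gmax n).1 :=
    fun r h1 h2 => adaPFOLState_eq_of_mem Gmax h1 h2
  generalize hGdef : adaPFOLState Gmax n = σ at *
  obtain ⟨G, s⟩ := σ
  dsimp only at *
  have hG0 : 0 < G := by linarith
  have hD := l1diam_nonneg X
  set m := n + 1 - s with hm
  -- The losses which the current instance is fed; squares of their norms are at most the norms,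
  -- which turns the sum of squares in the guarantee into `S / G`.
  set g' : ℕ → ι → ℝ := fun i => G⁻¹ • g (s + i) with hg'
  have hnorm : ∀ i, ‖g' i‖ = G⁻¹ * ‖g (s + i)‖ := fun i => by
    rw [hg', norm_smul, Real.norm_of_nonneg (inv_nonneg.2 hG0.le)]
  have hg1 : ∀ i < m, ‖g' i‖ ≤ 1 := by
    intro i hi
    rw [hnorm, inv_mul_le_iff₀ hG0, mul_one]
    exact (hg _ (by omega)).trans (hst _ (by omega) (by omega)).2
  have hreg := hA m g' (fun i => u (s + i)) hg1 fun i hi => hu _ (by omega)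
  have hlhs : ∑ t ∈ Finset.Ico s (n + 1), g t ⬝ᵥ (adaPFOL A Gmax g t - u t)
      = G * dynamicRegret m g' (A.action g') (fun i => u (s + i)) := by
    rw [Finset.sum_Ico_eq_sum_range, dynamicRegret, Finset.mul_sum]
    refine Finset.sum_congr rfl fun i hi => ?_
    have hi' := Finset.mem_range.1 hi
    rw [adaPFOL_eq_action, (hst (s + i) (by omega) (by omega)).1]
    dsimp only
    rw [Nat.add_sub_cancel_left, Finset.mul_sum]
    refine Finset.sum_congr rfl fun k _ => ?_
    simp only [hg', Pi.sub_apply, Pi.smul_apply, smul_eq_mul]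
    field_simp
  set S := ∑ t ∈ Finset.Ico s (n + 1), ‖g t‖ with hS
  have hS0 : 0 ≤ S := Finset.sum_nonneg fun _ _ => norm_nonneg _
  have hsq : ∑ i ∈ Finset.range m, ‖g' i‖ ^ 2 ≤ S / G := by
    calc ∑ i ∈ Finset.range m, ‖g' i‖ ^ 2 ≤ ∑ i ∈ Finset.range m, ‖g' i‖ :=
          Finset.sum_le_sum fun i hi =>
            pow_le_of_le_one (norm_nonneg _) (hg1 i (Finset.mem_range.1 hi)) two_ne_zero
      _ = S / G := by
          rw [hS, Finset.sum_Ico_eq_sum_range, div_eq_inv_mul, Finset.mul_sum]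
          exact Finset.sum_congr rfl fun i _ => hnorm i
  have hsq' : ∑ i ∈ Finset.range m, ‖g' i‖ ^ 2 ≤ T := by
    calc ∑ i ∈ Finset.range m, ‖g' i‖ ^ 2 ≤ ∑ i ∈ Finset.range m, (1 : ℝ) :=
          Finset.sum_le_sum fun i hi =>
            pow_le_one₀ (norm_nonneg _) (hg1 i (Finset.mem_range.1 hi))
      _ = m := by simp
      _ ≤ T := by exact_mod_cast (by omega : m ≤ T)
  have hsq0 : 0 ≤ ∑ i ∈ Finset.range m, ‖g' i‖ ^ 2 := Finset.sum_nonneg fun _ _ => sq_nonneg _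
  have hmT : (m : ℝ) ≤ T := by exact_mod_cast (by omega : m ≤ T)
  have hpath : ∑ i ∈ Finset.range (m - 1), l1norm (u (s + i) - u (s + (i + 1)))
      ≤ ∑ t ∈ Finset.range (T - 1), l1norm (u t - u (t + 1)) := by
    have h1 := Finset.sum_Ico_eq_sum_range (fun t => l1norm (u t - u (t + 1))) s n
    rw [show m - 1 = n - s by omega]
    simp only [← add_assoc]
    rw [← h1]
    exact Finset.sum_le_sum_of_subset_of_nonneg
      (fun t ht => Finset.mem_range.2 (by have := Finset.mem_Ico.1 ht; omega))
      fun _ _ _ => l1norm_nonneg _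
  have hpath0 : 0 ≤ ∑ i ∈ Finset.range (m - 1), l1norm (u (s + i) - u (s + (i + 1))) :=
    Finset.sum_nonneg fun _ _ => l1norm_nonneg _
  have hm0 : (0 : ℝ) ≤ m := Nat.cast_nonneg _
  have hlog : Real.log (2 + m * ∑ i ∈ Finset.range m, ‖g' i‖ ^ 2)
      ≤ Real.log (2 + (T : ℝ) ^ 2) := by
    refine Real.log_le_log (by positivity) ?_
    have := mul_le_mul hmT hsq' hsq0 (by positivity)
    rw [sq]
    linarith
  have hlog0 : 0 ≤ Real.log (2 + m * ∑ i ∈ Finset.range m, ‖g' i‖ ^ 2) := by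
    refine Real.log_nonneg ?_
    have := mul_nonneg hm0 hsq0
    linarith
  have hscale : G * √(1 + S / G) = √(G * (G + S)) := by
    nth_rewrite 1 [← Real.sqrt_sq hG0.le]
    rw [← Real.sqrt_mul (sq_nonneg G)]
    congr 1
    field_simp
  rw [hlhs]
  calc G * dynamicRegret m g' (A.action g') (fun i => u (s + i))
      ≤ G * (|K| * √(l1diam X * (l1diam X
            + ∑ t ∈ Finset.range (T - 1), l1norm (u t - u (t + 1)))) *
          √(1 + S / G) * Real.log (2 + (T : ℝ) ^ 2)) := by
        refine mul_le_mul_of_nonneg_left (hreg.trans ?_) hG0.le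
        refine mul_le_mul ?_ hlog hlog0 (by positivity)
        refine mul_le_mul ?_ (Real.sqrt_le_sqrt (by linarith)) (Real.sqrt_nonneg _)
          (by positivity)
        refine mul_le_mul (le_abs_self K) (Real.sqrt_le_sqrt ?_) (Real.sqrt_nonneg _)
          (abs_nonneg K)
        exact mul_le_mul_of_nonneg_left (by linarith) hD
    _ = _ := by
        rw [← hscale]
        ring

/-- The regret of AdaPFOL with final scale `G` is at most
`|K| √(D (D + P)) log (2 + T²) √(2 G (2 G + ∑ ‖g_t‖))`: since the scale at least doubles at each
restart, the bounds for the individual instances add up, by `√a + √b ≤ √(2 (a + b))`, to a bound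
of the same form. -/
theorem adaPFOL_regret {A : OLOAlgorithm X} {K : ℝ} (hA : IsPFOL A K) {Gmax : ℕ → ℝ}
    {g u : ℕ → ι → ℝ} {T : ℕ} (hg : ∀ t < T, ‖g t‖ ≤ Gmax t)
    (hu : ∀ t < T, u t ∈ X) {n : ℕ} (hnT : n < T) :
    ∑ t ∈ Finset.range (n + 1), g t ⬝ᵥ (adaPFOL A Gmax g t - u t) ≤
      |K| * √(l1diam X * (l1diam X + ∑ t ∈ Finset.range (T - 1), l1norm (u t - u (t + 1)))) *
        Real.log (2 + (T : ℝ) ^ 2) *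
        √(2 * (adaPFOLState Gmax n).1 * (2 * (adaPFOLState Gmax n).1
          + ∑ t ∈ Finset.range (n + 1), ‖g t‖)) := by
  induction n using Nat.strong_induction_on with
  | _ n ih =>
    have hseg := adaPFOL_regret_segment hA hnT hg hu
    have hG1 := one_le_adaPFOLState Gmax n
    have hsn := adaPFOLState_snd_le Gmax n
    set κ := |K| * √(l1diam X * (l1diam X
      + ∑ t ∈ Finset.range (T - 1), l1norm (u t - u (t + 1)))) * Real.log (2 + (T : ℝ) ^ 2)
      with hκ
    have hκ0 : 0 ≤ κ := mul_nonneg (by positivity) (Real.log_nonneg (by nlinarith))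
    set G := (adaPFOLState Gmax n).1 with hG
    set s := (adaPFOLState Gmax n).2 with hs
    rw [← Finset.sum_range_add_sum_Ico _ (show s ≤ n + 1 by omega),
      ← Finset.sum_range_add_sum_Ico (fun t => ‖g t‖) (show s ≤ n + 1 by omega)]
    set S1 := ∑ t ∈ Finset.range s, ‖g t‖ with hS1
    set S2 := ∑ t ∈ Finset.Ico s (n + 1), ‖g t‖ with hS2
    have hS10 : 0 ≤ S1 := Finset.sum_nonneg fun _ _ => norm_nonneg _
    have hS20 : 0 ≤ S2 := Finset.sum_nonneg fun _ _ => norm_nonneg _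
    have hprev : ∑ t ∈ Finset.range s, g t ⬝ᵥ (adaPFOL A Gmax g t - u t)
        ≤ κ * √(G * (G + S1)) := by
      rcases Nat.eq_zero_or_pos s with h0 | hpos
      · rw [h0, Finset.range_zero, Finset.sum_empty]
        positivity
      · obtain ⟨r, hr⟩ : ∃ r, s = r + 1 := ⟨s - 1, by omega⟩
        have hd : 2 * (adaPFOLState Gmax r).1 ≤ G := two_mul_adaPFOLState_le Gmax hr
        have h1 := one_le_adaPFOLState Gmax r
        have hr' := ih r (by omega) (by omega)
        rw [← hr, ← hS1] at hr'
        refine hr'.trans ?_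
        refine mul_le_mul_of_nonneg_left (Real.sqrt_le_sqrt ?_) hκ0
        exact mul_le_mul hd (by linarith) (by linarith) (by linarith)
    have hsqrt : √(G * (G + S1)) + √(G * (G + S2)) ≤ √(2 * G * (2 * G + (S1 + S2))) := by
      refine Real.le_sqrt_of_sq_le ?_
      have h1 := Real.sq_sqrt (show 0 ≤ G * (G + S1) by positivity)
      have h2 := Real.sq_sqrt (show 0 ≤ G * (G + S2) by positivity)
      nlinarith [sq_nonneg (√(G * (G + S1)) - √(G * (G + S2)))]
    calc _ ≤ κ * √(G * (G + S1)) + κ * √(G * (G + S2)) := add_le_add hprev hseg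
      _ = κ * (√(G * (G + S1)) + √(G * (G + S2))) := by ring
      _ ≤ _ := mul_le_mul_of_nonneg_left hsqrt hκ0

end AdaPFOL

/-! ### Queues along a sample path -/

namespace Network

theorem queue_succ {𝒩 : Type*} [DecidableEq 𝒩] (net : Network 𝒩) (mu : ℕ → 𝒩 × 𝒩 → 𝒩 → ℝ)
    (t : ℕ) (n k : 𝒩) :
    net.queue mu (t + 1) n k = if k = n then 0
      else max (net.queue mu t n k - net.outflow (mu t) n k) 0
        + net.inflow (mu t) n k + net.arrival t n k :=
  rfl

theorem queue_self {𝒩 : Type*} [DecidableEq 𝒩] (net : Network 𝒩) (mu : ℕ → 𝒩 × 𝒩 → 𝒩 → ℝ)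
    (t : ℕ) (n : 𝒩) :
    net.queue mu t n n = 0 := by
  cases t with
  | zero => rfl
  | succ t => rw [queue_succ, if_pos rfl]

variable {𝒩 : Type*} [Fintype 𝒩] [DecidableEq 𝒩]

/-- The transmissions of the first `T` rounds lie in `[0, M]`. -/
def FlowBounded (net : Network 𝒩) (T : ℕ) (M : ℝ) (f : ℕ → 𝒩 × 𝒩 → 𝒩 → ℝ) : Prop :=
  ∀ t < T, ∀ l ∈ net.links, ∀ k, f t l k ∈ Set.Icc 0 M

/-- The total queue length `‖Q(t)‖₁` in round `t`. -/
noncomputable def queueNorm (net : Network 𝒩) (mu : ℕ → 𝒩 × 𝒩 → 𝒩 → ℝ) (t : ℕ) : ℝ :=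
  ∑ n, l1norm (net.queue mu t n)

/-- The inner product of the queues of round `t` with the net service of the flow `f`: the rate at
which `f` decreases the Lyapunov function `‖Q‖₂² / 2`, to first order. -/
noncomputable def drain (net : Network 𝒩) (mu : ℕ → 𝒩 × 𝒩 → 𝒩 → ℝ) (f : 𝒩 × 𝒩 → 𝒩 → ℝ)
    (t : ℕ) : ℝ :=
  ∑ n, ∑ k, net.queue mu t n k * (net.outflow f n k - (net.arrival t n k + net.inflow f n k))

/-- By regrouping the flows by links, the drain becomes the sum of the link utilities. -/
theorem drain_eq (net : Network 𝒩) (mu : ℕ → 𝒩 × 𝒩 → 𝒩 → ℝ) (f : 𝒩 × 𝒩 → 𝒩 → ℝ) (t : ℕ) :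
    net.drain mu f t = ∑ l ∈ net.links, ∑ k, (net.queue mu t l.1 k - net.queue mu t l.2 k) * f l k
      - ∑ n, ∑ k, net.queue mu t n k * net.arrival t n k := by
  have hswap : ∀ p : 𝒩 × 𝒩 → 𝒩,
      ∑ n, ∑ k, net.queue mu t n k * ∑ l ∈ net.links with p l = n, f l k
        = ∑ l ∈ net.links, ∑ k, net.queue mu t (p l) k * f l k := by
    intro p
    rw [← Finset.sum_fiberwise net.links p]
    refine Finset.sum_congr rfl fun n _ => ?_
    simp only [Finset.mul_sum]
    rw [Finset.sum_comm]
    refine Finset.sum_congr rfl fun l hl => ?_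
    rw [(Finset.mem_filter.1 hl).2]
  have h1 := hswap Prod.fst
  have h2 := hswap Prod.snd
  simp only [drain, mul_sub, mul_add, sub_mul, Finset.sum_sub_distrib, Finset.sum_add_distrib]
  unfold outflow inflow
  rw [h1, h2]
  ring

variable {net : Network 𝒩} {T : ℕ} {M R : ℝ} {mu : ℕ → 𝒩 × 𝒩 → 𝒩 → ℝ}

theorem outflow_mem_Icc (hM : 0 ≤ M) {f : 𝒩 × 𝒩 → 𝒩 → ℝ}
    (hf : ∀ l ∈ net.links, ∀ k, f l k ∈ Set.Icc 0 M) (n k : 𝒩) :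
    net.outflow f n k ∈ Set.Icc 0 (Fintype.card 𝒩 * M) := by
  refine ⟨Finset.sum_nonneg fun l hl => (hf l (Finset.mem_filter.1 hl).1 k).1, ?_⟩
  refine (Finset.sum_le_card_nsmul _ _ M fun l hl => (hf l (Finset.mem_filter.1 hl).1 k).2).trans ?_
  rw [nsmul_eq_mul]
  refine mul_le_mul_of_nonneg_right ?_ hM
  refine Nat.cast_le.2 (Finset.card_le_card_of_injOn Prod.snd (fun _ _ => Finset.mem_univ _) ?_)
  intro l hl l' hl' h
  have h1 := (Finset.mem_filter.1 hl).2
  have h2 := (Finset.mem_filter.1 hl').2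
  exact Prod.ext (h1.trans h2.symm) h

theorem inflow_mem_Icc (hM : 0 ≤ M) {f : 𝒩 × 𝒩 → 𝒩 → ℝ}
    (hf : ∀ l ∈ net.links, ∀ k, f l k ∈ Set.Icc 0 M) (n k : 𝒩) :
    net.inflow f n k ∈ Set.Icc 0 (Fintype.card 𝒩 * M) := by
  refine ⟨Finset.sum_nonneg fun l hl => (hf l (Finset.mem_filter.1 hl).1 k).1, ?_⟩
  refine (Finset.sum_le_card_nsmul _ _ M fun l hl => (hf l (Finset.mem_filter.1 hl).1 k).2).trans ?_
  rw [nsmul_eq_mul]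
  refine mul_le_mul_of_nonneg_right ?_ hM
  refine Nat.cast_le.2 (Finset.card_le_card_of_injOn Prod.fst (fun _ _ => Finset.mem_univ _) ?_)
  intro l hl l' hl' h
  have h1 := (Finset.mem_filter.1 hl).2
  have h2 := (Finset.mem_filter.1 hl').2
  exact Prod.ext h (h1.trans h2.symm)

theorem queue_nonneg (hM : 0 ≤ M) (hb : net.IsBounded T M R) (hmu : net.FlowBounded T M mu)
    {t : ℕ} (ht : t ≤ T) (n k : 𝒩) : 0 ≤ net.queue mu t n k := by
  cases t with
  | zero => exact le_rfl
  | succ t =>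
    have h1 := (inflow_mem_Icc hM (hmu t ht) n k).1
    have h2 := (hb.2 t ht n k).1
    rw [queue_succ]
    split_ifs
    · exact le_rfl
    · have := le_max_right (net.queue mu t n k - net.outflow (mu t) n k) 0
      linarith

theorem abs_queue_succ_sub_le (hM : 0 ≤ M) (hR : 0 ≤ R) (hb : net.IsBounded T M R)
    (hmu : net.FlowBounded T M mu) {t : ℕ} (ht : t < T) (n k : 𝒩) :
    |net.queue mu (t + 1) n k - net.queue mu t n k| ≤ Fintype.card 𝒩 * M + R := by
  have ho := outflow_mem_Icc hM (hmu t ht) n k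
  have hi := inflow_mem_Icc hM (hmu t ht) n k
  have ha := hb.2 t ht n k
  have hq := queue_nonneg hM hb hmu ht.le n k
  by_cases hkn : k = n
  · subst hkn
    rw [queue_self, queue_self, sub_zero, abs_zero]
    positivity
  · rw [queue_succ, if_neg hkn, abs_le]
    have h1 := le_max_left (net.queue mu t n k - net.outflow (mu t) n k) 0
    have h2 : max (net.queue mu t n k - net.outflow (mu t) n k) 0 ≤ net.queue mu t n k :=
      max_le (by linarith [ho.1]) hq
    constructor <;> linarith [ho.1, ho.2, hi.1, hi.2, ha.1, ha.2]

theorem queueNorm_nonneg (t : ℕ) : 0 ≤ net.queueNorm mu t :=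
  Finset.sum_nonneg fun _ _ => l1norm_nonneg _

theorem queue_le_queueNorm (t : ℕ) (n k : 𝒩) : |net.queue mu t n k| ≤ net.queueNorm mu t := by
  have h1 : |net.queue mu t n k| ≤ l1norm (net.queue mu t n) :=
    Finset.single_le_sum (f := fun k => |net.queue mu t n k|) (fun _ _ => abs_nonneg _)
      (Finset.mem_univ k)
  exact h1.trans (Finset.single_le_sum (f := fun n => l1norm (net.queue mu t n))
    (fun _ _ => l1norm_nonneg _) (Finset.mem_univ n))

theorem norm_queue_sub_le (hM : 0 ≤ M) (hb : net.IsBounded T M R) (hmu : net.FlowBounded T M mu)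
    {t : ℕ} (ht : t ≤ T) (m n : 𝒩) :
    ‖net.queue mu t m - net.queue mu t n‖ ≤ net.queueNorm mu t := by
  refine (pi_norm_le_iff_of_nonneg (queueNorm_nonneg t)).2 fun k => ?_
  have h1 := queue_nonneg hM hb hmu ht m k
  have h2 := queue_nonneg hM hb hmu ht n k
  have h3 := (le_abs_self _).trans (queue_le_queueNorm (net := net) (mu := mu) t m k)
  have h4 := (le_abs_self _).trans (queue_le_queueNorm (net := net) (mu := mu) t n k)
  rw [Pi.sub_apply, Real.norm_eq_abs, abs_le]
  constructor <;> linarith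

theorem queueNorm_eq_sum (hM : 0 ≤ M) (hb : net.IsBounded T M R) (hmu : net.FlowBounded T M mu)
    {t : ℕ} (ht : t ≤ T) : net.queueNorm mu t = ∑ n, ∑ k, net.queue mu t n k :=
  Finset.sum_congr rfl fun n _ => Finset.sum_congr rfl fun k _ =>
    abs_of_nonneg (queue_nonneg hM hb hmu ht n k)

theorem queueNorm_succ_sub_le (hM : 0 ≤ M) (hR : 0 ≤ R) (hb : net.IsBounded T M R)
    (hmu : net.FlowBounded T M mu) {t : ℕ} (ht : t < T) :
    net.queueNorm mu (t + 1) - net.queueNorm mu t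
      ≤ (Fintype.card 𝒩 : ℝ) ^ 2 * (Fintype.card 𝒩 * M + R) := by
  rw [queueNorm_eq_sum hM hb hmu ht, queueNorm_eq_sum hM hb hmu ht.le, ← Finset.sum_sub_distrib]
  simp only [← Finset.sum_sub_distrib]
  calc ∑ n, ∑ k, (net.queue mu (t + 1) n k - net.queue mu t n k)
      ≤ ∑ _n : 𝒩, ∑ _k : 𝒩, ((Fintype.card 𝒩 : ℝ) * M + R) :=
        Finset.sum_le_sum fun n _ => Finset.sum_le_sum fun k _ =>
          (le_abs_self _).trans (abs_queue_succ_sub_le hM hR hb hmu ht n k)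
    _ = _ := by
        simp only [Finset.sum_const, Finset.card_univ, nsmul_eq_mul]
        ring

/-- A sequence that starts at `0` and has increments at most `β` has a large sum once it gets
large; hence the queue length at any time is at most of the order of the square root of the total
queue length. -/
theorem sq_queueNorm_le (hM : 0 ≤ M) (hR : 0 ≤ R) (hb : net.IsBounded T M R)
    (hmu : net.FlowBounded T M mu) {t : ℕ} (ht : t < T) :
    net.queueNorm mu t ^ 2
      ≤ 2 * ((Fintype.card 𝒩 : ℝ) ^ 2 * (Fintype.card 𝒩 * M + R)) * net.totalQueue mu T := by
  set β := (Fintype.card 𝒩 : ℝ) ^ 2 * (Fintype.card 𝒩 * M + R) with hβ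
  have hβ0 : 0 ≤ β := by positivity
  have key : ∀ r < T, net.queueNorm mu r ^ 2 + β * net.queueNorm mu r
      ≤ 2 * β * ∑ s ∈ Finset.range (r + 1), net.queueNorm mu s := by
    intro r
    induction r with
    | zero =>
      intro _
      have h0 : net.queueNorm mu 0 = 0 := by simp [queueNorm, l1norm, queue]
      simp [h0]
    | succ r ih =>
      intro hr
      have h1 := ih (by omega)
      have h2 := queueNorm_succ_sub_le hM hR hb hmu (show r < T by omega)
      have h3 := queueNorm_nonneg (net := net) (mu := mu) r
      have h4 := queueNorm_nonneg (net := net) (mu := mu) (r + 1)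
      rw [Finset.sum_range_succ]
      nlinarith
  have h1 := key t ht
  have h2 : ∑ s ∈ Finset.range (t + 1), net.queueNorm mu s ≤ net.totalQueue mu T :=
    Finset.sum_le_sum_of_subset_of_nonneg
      (fun s hs => Finset.mem_range.2 (by have := Finset.mem_range.1 hs; omega))
      fun s _ _ => queueNorm_nonneg s
  have h3 := mul_nonneg hβ0 (queueNorm_nonneg (net := net) (mu := mu) t)
  have h4 := mul_le_mul_of_nonneg_left h2 (show 0 ≤ 2 * β by positivity)
  linarith

/-! ### Lyapunov drift -/

/-- The drift of a single queue. -/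
theorem sq_queue_succ_le (hM : 0 ≤ M) (hb : net.IsBounded T M R)
    (hmu : net.FlowBounded T M mu) {t : ℕ} (ht : t < T) (n k : 𝒩) :
    net.queue mu (t + 1) n k ^ 2 ≤ net.queue mu t n k ^ 2
      + ((Fintype.card 𝒩 * M) ^ 2 + (Fintype.card 𝒩 * M + R) ^ 2)
      - 2 * (net.queue mu t n k * (net.outflow (mu t) n k
        - (net.arrival t n k + net.inflow (mu t) n k))) := by
  by_cases hkn : k = n
  · subst hkn
    rw [queue_self, queue_self]
    nlinarith [sq_nonneg ((Fintype.card 𝒩 : ℝ) * M), sq_nonneg ((Fintype.card 𝒩 : ℝ) * M + R)]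
  · have ho := outflow_mem_Icc hM (hmu t ht) n k
    have hi := inflow_mem_Icc hM (hmu t ht) n k
    have ha := hb.2 t ht n k
    have hq := queue_nonneg hM hb hmu ht.le n k
    rw [queue_succ, if_neg hkn]
    set q := net.queue mu t n k
    set o := net.outflow (mu t) n k
    set i := net.inflow (mu t) n k
    set a := net.arrival t n k
    have h1 : (max (q - o) 0) ^ 2 ≤ (q - o) ^ 2 := by
      rcases le_total (q - o) 0 with h | h
      · rw [max_eq_right h]
        nlinarith
      · rw [max_eq_left h]
    have h2 : max (q - o) 0 ≤ q := max_le (by linarith [ho.1]) hq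
    have h3 : o ^ 2 ≤ (Fintype.card 𝒩 * M) ^ 2 := pow_le_pow_left₀ ho.1 ho.2 2
    have h4 : (i + a) ^ 2 ≤ (Fintype.card 𝒩 * M + R) ^ 2 :=
      pow_le_pow_left₀ (add_nonneg hi.1 ha.1) (add_le_add hi.2 ha.2) 2
    have h5 := mul_le_mul_of_nonneg_right h2 (add_nonneg hi.1 ha.1)
    linarith [show (max (q - o) 0 + i + a) ^ 2
      = (max (q - o) 0) ^ 2 + 2 * (max (q - o) 0 * (i + a)) + (i + a) ^ 2 by ring]

theorem sum_drain_le (hM : 0 ≤ M) (hb : net.IsBounded T M R)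
    (hmu : net.FlowBounded T M mu) :
    ∑ t ∈ Finset.range T, net.drain mu (mu t) t ≤ (Fintype.card 𝒩 : ℝ) ^ 2 *
      ((Fintype.card 𝒩 * M) ^ 2 + (Fintype.card 𝒩 * M + R) ^ 2) / 2 * T := by
  have hstep : ∀ t ∈ Finset.range T, 2 * net.drain mu (mu t) t ≤
      (∑ n, ∑ k, net.queue mu t n k ^ 2 - ∑ n, ∑ k, net.queue mu (t + 1) n k ^ 2)
      + (Fintype.card 𝒩 : ℝ) ^ 2 *
        ((Fintype.card 𝒩 * M) ^ 2 + (Fintype.card 𝒩 * M + R) ^ 2) := by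
    intro t ht
    have h := Finset.sum_le_sum fun n (_ : n ∈ Finset.univ) =>
      Finset.sum_le_sum fun k (_ : k ∈ Finset.univ) =>
        sq_queue_succ_le hM hb hmu (Finset.mem_range.1 ht) n k
    simp only [Finset.sum_sub_distrib, Finset.sum_add_distrib, ← Finset.mul_sum, Finset.sum_const,
      Finset.card_univ, nsmul_eq_mul] at h
    rw [drain]
    linarith
  have h := Finset.sum_le_sum hstep
  rw [← Finset.mul_sum, Finset.sum_add_distrib,
    Finset.sum_range_sub' (fun t => ∑ n, ∑ k, net.queue mu t n k ^ 2)] at h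
  simp only [Finset.sum_const, Finset.card_range, nsmul_eq_mul] at h
  have h0 : ∑ n, ∑ k, net.queue mu 0 n k ^ 2 = 0 := by simp [queue]
  have hT : 0 ≤ ∑ n, ∑ k, net.queue mu T n k ^ 2 :=
    Finset.sum_nonneg fun _ _ => Finset.sum_nonneg fun _ _ => sq_nonneg _
  linarith

/-! ### Piecewise stability -/

theorem sum_range_cast_le_sq {m : ℕ} (hm : 1 ≤ m) :
    ∑ s ∈ Finset.range m, (s : ℝ) ≤ ((m : ℝ) - 1) ^ 2 := by
  induction m, hm using Nat.le_induction with
  | base => simp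
  | succ m hm ih =>
    rw [Finset.sum_range_succ]
    have : (1 : ℝ) ≤ m := by exact_mod_cast hm
    push_cast
    nlinarith

/-- If `x` averages at least `ε` on an interval, then `∑ q x ≥ ε ∑ q` up to the variation of `q`
on the interval. -/
theorem mul_sum_Ico_le {q x : ℕ → ℝ} {b ε : ℝ} {i j : ℕ} (hij : i < j) (hε : 0 ≤ ε)
    (hb : 0 ≤ b) (hq : ∀ t, i ≤ t → t + 1 < j → |q (t + 1) - q t| ≤ b) (hqi : 0 ≤ q i)
    (hx : ∀ t ∈ Finset.Ico i j, |x t| ≤ b)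
    (hsum : ε * ((j - i : ℕ) : ℝ) ≤ ∑ t ∈ Finset.Ico i j, x t) :
    ε * ∑ t ∈ Finset.Ico i j, q t ≤ ∑ t ∈ Finset.Ico i j, q t * x t
      + (((j - i : ℕ) : ℝ) - 1) ^ 2 * (b ^ 2 + ε * b) := by
  have hvar : ∀ s, i + s < j → |q (i + s) - q i| ≤ s * b := by
    intro s
    induction s with
    | zero => intro _; simp
    | succ s ih =>
      intro hs
      have h1 := ih (by omega)
      have h2 := hq (i + s) (by omega) (by omega)
      have h3 := abs_sub_le (q (i + s + 1)) (q (i + s)) (q i)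
      rw [← add_assoc]
      push_cast
      linarith
  have hstart : 0 ≤ q i * ∑ t ∈ Finset.Ico i j, (x t - ε) := by
    refine mul_nonneg hqi ?_
    rw [Finset.sum_sub_distrib, Finset.sum_const, Nat.card_Ico, nsmul_eq_mul]
    linarith
  have hrest : -((((j - i : ℕ) : ℝ) - 1) ^ 2 * (b ^ 2 + ε * b))
      ≤ ∑ t ∈ Finset.Ico i j, (q t - q i) * (x t - ε) := by
    rw [Finset.sum_Ico_eq_sum_range]
    calc -((((j - i : ℕ) : ℝ) - 1) ^ 2 * (b ^ 2 + ε * b))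
        ≤ -((∑ s ∈ Finset.range (j - i), (s : ℝ)) * (b ^ 2 + ε * b)) := by
          have := sum_range_cast_le_sq (show 1 ≤ j - i by omega)
          exact neg_le_neg (mul_le_mul_of_nonneg_right this (by positivity))
      _ = ∑ s ∈ Finset.range (j - i), -((s : ℝ) * (b ^ 2 + ε * b)) := by
          rw [Finset.sum_mul, Finset.sum_neg_distrib]
      _ ≤ _ := by
          refine Finset.sum_le_sum fun s hs => ?_
          have hs' := Finset.mem_range.1 hs
          have h1 := hvar s (by omega)
          have h2 := hx (i + s) (Finset.mem_Ico.2 ⟨by omega, by omega⟩)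
          have h3 : |x (i + s) - ε| ≤ b + ε := by
            rw [abs_le] at h2 ⊢
            constructor <;> linarith
          have h4 := mul_le_mul h1 h3 (abs_nonneg _) (by positivity)
          rw [← abs_mul] at h4
          have h5 := (abs_le.1 h4).1
          linarith [show (s : ℝ) * b * (b + ε) = s * (b ^ 2 + ε * b) by ring]
  have hsplit : ∑ t ∈ Finset.Ico i j, q t * x t - ε * ∑ t ∈ Finset.Ico i j, q t
      = q i * ∑ t ∈ Finset.Ico i j, (x t - ε) + ∑ t ∈ Finset.Ico i j, (q t - q i) * (x t - ε) := by
    rw [Finset.mul_sum, Finset.mul_sum, ← Finset.sum_sub_distrib, ← Finset.sum_add_distrib]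
    exact Finset.sum_congr rfl fun t _ => by ring
  linarith

theorem sum_parts_range {T : ℕ} (W : Finpartition (Finset.range T)) (f : ℕ → ℝ) :
    ∑ w ∈ W.parts, ∑ t ∈ w, f t = ∑ t ∈ Finset.range T, f t := by
  conv_rhs => rw [← W.biUnion_parts]
  exact (Finset.sum_biUnion W.supIndep.pairwiseDisjoint).symm

/-- Piecewise stable reference allocations drain the network at rate `εW` times the total queue
length, up to the variation of the queues within the intervals. -/
theorem mul_totalQueue_le (hM : 0 ≤ M) (hR : 0 ≤ R) (hb : net.IsBounded T M R)
    (hmu : net.FlowBounded T M mu) {CW εW : ℝ} (hε : 0 < εW) {a : ℕ → 𝒩 × 𝒩 → 𝒩 → ℝ}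
    (ha : net.PiecewiseStable T CW εW a) :
    εW * net.totalQueue mu T ≤
      ∑ t ∈ Finset.range T, net.drain mu (fun l k => net.cap t l * a t l k) t
      + (Fintype.card 𝒩 : ℝ) ^ 2 * ((Fintype.card 𝒩 * M + R) ^ 2
        + εW * (Fintype.card 𝒩 * M + R)) * (CW * T) := by
  obtain ⟨hsimplex, W, hW, hCW, hstab⟩ := ha
  set b := (Fintype.card 𝒩 : ℝ) * M + R with hbdef
  have hb0 : 0 ≤ b := by positivity
  set x : ℕ → 𝒩 → 𝒩 → ℝ := fun t n k => net.outflow (fun l k => net.cap t l * a t l k) n k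
    - (net.arrival t n k + net.inflow (fun l k => net.cap t l * a t l k) n k) with hx
  have hflow : net.FlowBounded T M (fun t l k => net.cap t l * a t l k) := by
    intro t ht l hl k
    have h1 := hb.1 t ht l hl
    have h2 := (hsimplex t ht l hl).1 k
    have h3 := apply_le_one_of_mem_stdSimplex (hsimplex t ht l hl) k
    exact ⟨mul_nonneg h1.1 h2, (mul_le_of_le_one_right h1.1 h3).trans h1.2⟩
  have hxb : ∀ t < T, ∀ n k, |x t n k| ≤ b := by
    intro t ht n k
    have h1 := outflow_mem_Icc hM (hflow t ht) n k
    have h2 := inflow_mem_Icc hM (hflow t ht) n k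
    have h3 := hb.2 t ht n k
    rw [abs_le]
    simp only [hx, hbdef]
    constructor <;> linarith [h1.1, h1.2, h2.1, h2.2, h3.1, h3.2]
  have hpair : ∀ n k, εW * ∑ t ∈ Finset.range T, net.queue mu t n k
      ≤ ∑ t ∈ Finset.range T, net.queue mu t n k * x t n k
        + (b ^ 2 + εW * b) * (CW * T) := by
    intro n k
    have hpart : ∀ w ∈ W.parts, εW * ∑ t ∈ w, net.queue mu t n k
        ≤ ∑ t ∈ w, net.queue mu t n k * x t n k
          + ((w.card : ℝ) - 1) ^ 2 * (b ^ 2 + εW * b) := by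
      intro w hw
      by_cases hkn : k = n
      · subst hkn
        simp only [queue_self, zero_mul, Finset.sum_const_zero, mul_zero, zero_add]
        positivity
      · have hs := hstab w hw n k hkn
        have hne := W.nonempty_of_mem_parts hw
        have hsub : w ⊆ Finset.range T := W.le hw
        have hcard : (0 : ℝ) < w.card := by exact_mod_cast Finset.card_pos.2 hne
        have hs' : εW * (w.card : ℝ) ≤ ∑ t ∈ w, x t n k := by
          rw [hx, Finset.sum_sub_distrib]
          rw [ge_iff_le, one_div, ← le_sub_iff_add_le, ← mul_sub, ← div_eq_inv_mul,
            le_div_iff₀ hcard] at hs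
          exact hs
        obtain ⟨i, j, rfl⟩ := hW w hw
        have hij : i < j := Finset.nonempty_Ico.1 hne
        have hlt : ∀ t ∈ Finset.Ico i j, t < T := fun t ht => Finset.mem_range.1 (hsub ht)
        rw [Nat.card_Ico] at hs' ⊢
        refine mul_sum_Ico_le (q := fun t => net.queue mu t n k) hij hε.le hb0 ?_ ?_
          (fun t ht => hxb t (hlt t ht) n k) hs'
        · intro t h1 h2
          exact abs_queue_succ_sub_le hM hR hb hmu
            (hlt t (Finset.mem_Ico.2 ⟨h1, by omega⟩)) n k
        · exact queue_nonneg hM hb hmu (hlt i (Finset.left_mem_Ico.2 hij)).le n k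
    have h := Finset.sum_le_sum hpart
    rw [Finset.sum_add_distrib, ← Finset.mul_sum, sum_parts_range, sum_parts_range,
      ← Finset.sum_mul] at h
    have h2 := mul_le_mul_of_nonneg_right hCW (show 0 ≤ b ^ 2 + εW * b by positivity)
    linarith
  have h := Finset.sum_le_sum fun n (_ : n ∈ Finset.univ) =>
    Finset.sum_le_sum fun k (_ : k ∈ Finset.univ) => hpair n k
  simp only [Finset.sum_add_distrib, ← Finset.mul_sum, Finset.sum_const, Finset.card_univ,
    nsmul_eq_mul] at h
  have hswap : ∀ f : ℕ → 𝒩 → 𝒩 → ℝ, ∑ n, ∑ k, ∑ t ∈ Finset.range T, f t n k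
      = ∑ t ∈ Finset.range T, ∑ n, ∑ k, f t n k := by
    intro f
    rw [Finset.sum_comm (s := Finset.range T)]
    exact Finset.sum_congr rfl fun n _ => Finset.sum_comm
  have e1 : ∑ n, ∑ k, ∑ t ∈ Finset.range T, net.queue mu t n k = net.totalQueue mu T := by
    rw [hswap]
    exact Finset.sum_congr rfl fun t ht =>
      (queueNorm_eq_sum hM hb hmu (Finset.mem_range.1 ht).le).symm
  have e2 : ∑ n, ∑ k, ∑ t ∈ Finset.range T, net.queue mu t n k * x t n k
      = ∑ t ∈ Finset.range T, net.drain mu (fun l k => net.cap t l * a t l k) t :=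
    hswap _
  rw [e1, e2] at h
  linarith

end Network

/-! ### Regret of the network scheduler -/

namespace Network

variable {𝒩 : Type*} [Fintype 𝒩] [DecidableEq 𝒩]

variable {net : Network 𝒩} {T : ℕ} {M R : ℝ} {mu : ℕ → 𝒩 × 𝒩 → 𝒩 → ℝ}

/-- The scale reached by AdaPFOL on a link is of the order of the square root of the total queue
length. -/
theorem adaPFOLState_link_le (hM : 0 ≤ M) (hR : 0 ≤ R) (hb : net.IsBounded T M R)
    (hmu : net.FlowBounded T M mu) (l : 𝒩 × 𝒩) {n : ℕ} (hn : n < T) :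
    2 * (adaPFOLState (fun s => M * ‖net.queue mu s l.2 - net.queue mu s l.1‖) n).1 ≤
      (2 + 4 * M * √(2 * ((Fintype.card 𝒩 : ℝ) ^ 2 * (Fintype.card 𝒩 * M + R)))) *
        √(1 + net.totalQueue mu T) := by
  set β := 2 * ((Fintype.card 𝒩 : ℝ) ^ 2 * (Fintype.card 𝒩 * M + R)) with hβ
  have hβ0 : 0 ≤ β := by positivity
  have hS0 : 0 ≤ net.totalQueue mu T := Finset.sum_nonneg fun t _ => queueNorm_nonneg t
  have hroot : 1 ≤ √(1 + net.totalQueue mu T) := Real.one_le_sqrt.2 (by linarith)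
  have hroot' : √(net.totalQueue mu T) ≤ √(1 + net.totalQueue mu T) :=
    Real.sqrt_le_sqrt (by linarith)
  have h0 : 0 ≤ 4 * M * √β := by positivity
  rcases adaPFOLState_fst_eq (fun s => M * ‖net.queue mu s l.2 - net.queue mu s l.1‖) n with
    h | ⟨r, hr, h⟩
  · rw [h]
    nlinarith
  · rw [h]
    have h1 := norm_queue_sub_le hM hb hmu (show r ≤ T by omega) l.2 l.1
    have h2 : net.queueNorm mu r ≤ √β * √(1 + net.totalQueue mu T) := by
      have h3 := Real.le_sqrt_of_sq_le (sq_queueNorm_le hM hR hb hmu (show r < T by omega))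
      rw [Real.sqrt_mul hβ0] at h3
      exact h3.trans (mul_le_mul_of_nonneg_left hroot' (Real.sqrt_nonneg _))
    have h3 := mul_le_mul_of_nonneg_left (h1.trans h2) hM
    nlinarith

/-- The regret of the AdaPFOL instance on a single link, against comparators of path length `Pa`,
is of the order of the `3/4`-th power of the total queue length. -/
theorem link_regret_le (hM : 0 ≤ M) (hR : 0 ≤ R) (hb : net.IsBounded T M R)
    (hmu : net.FlowBounded T M mu) (hT : 1 ≤ T) {A : OLOAlgorithm (stdSimplex ℝ 𝒩)} {K : ℝ}
    (hA : IsPFOL A K) {a : ℕ → 𝒩 × 𝒩 → 𝒩 → ℝ} {l : 𝒩 × 𝒩} (hl : l ∈ net.links)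
    (ha : ∀ t < T, a t l ∈ stdSimplex ℝ 𝒩) {Pa : ℝ}
    (hPa : ∑ t ∈ Finset.range (T - 1), l1norm (a t l - a (t + 1) l) ≤ Pa) {c : ℝ}
    (hc : c = 2 + 4 * M * √(2 * ((Fintype.card 𝒩 : ℝ) ^ 2 * (Fintype.card 𝒩 * M + R)))) :
    ∑ t ∈ Finset.range T, (net.cap t l • (net.queue mu t l.2 - net.queue mu t l.1)) ⬝ᵥ
        (net.nsoAction M A mu t l - a t l) ≤
      |K| * √(2 * (2 + Pa)) * Real.log (2 + (T : ℝ) ^ 2) * √(c * (c + M)) *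
        √√(1 + net.totalQueue mu T) ^ 3 := by
  obtain ⟨n, rfl⟩ : ∃ n, T = n + 1 := ⟨T - 1, by omega⟩
  set S := net.totalQueue mu (n + 1) with hS
  have hS0 : 0 ≤ S := Finset.sum_nonneg fun t _ => queueNorm_nonneg t
  set g : ℕ → 𝒩 → ℝ := fun t => net.cap t l • (net.queue mu t l.2 - net.queue mu t l.1) with hg
  have hgle : ∀ t < n + 1, ‖g t‖ ≤ M * ‖net.queue mu t l.2 - net.queue mu t l.1‖ := by
    intro t ht
    have hcap := hb.1 t ht l hl
    rw [hg, norm_smul, Real.norm_of_nonneg hcap.1]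
    exact mul_le_mul_of_nonneg_right hcap.2 (norm_nonneg _)
  have hreg := adaPFOL_regret hA hgle ha (Nat.lt_succ_self n)
  refine hreg.trans ?_
  have hscale := adaPFOLState_link_le hM hR hb hmu l (Nat.lt_succ_self n)
  have hG1 := one_le_adaPFOLState
    (fun s => M * ‖net.queue mu s l.2 - net.queue mu s l.1‖) n
  rw [← hc] at hscale
  have hc0 : 0 ≤ c := by
    rw [hc]
    positivity
  set G := (adaPFOLState (fun s => M * ‖net.queue mu s l.2 - net.queue mu s l.1‖) n).1
  have hgsum : ∑ t ∈ Finset.range (n + 1), ‖g t‖ ≤ M * S := by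
    rw [hS, totalQueue, Finset.mul_sum]
    refine Finset.sum_le_sum fun t ht => ?_
    have ht' := Finset.mem_range.1 ht
    exact (hgle t ht').trans
      (mul_le_mul_of_nonneg_left (norm_queue_sub_le hM hb hmu ht'.le l.2 l.1) hM)
  have hgsum0 : 0 ≤ ∑ t ∈ Finset.range (n + 1), ‖g t‖ :=
    Finset.sum_nonneg fun _ _ => norm_nonneg _
  have hD0 := l1diam_nonneg (stdSimplex ℝ 𝒩)
  have hD2 := l1diam_stdSimplex_le_two (ι := 𝒩)
  have hP0 : 0 ≤ ∑ t ∈ Finset.range (n + 1 - 1), l1norm (a t l - a (t + 1) l) :=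
    Finset.sum_nonneg fun _ _ => l1norm_nonneg _
  set y := √√(1 + S) with hy
  have hy2 : √(1 + S) = y ^ 2 := (Real.sq_sqrt (Real.sqrt_nonneg _)).symm
  have hy4 : 1 + S = y ^ 4 := by
    rw [show y ^ 4 = (y ^ 2) ^ 2 by ring, ← hy2, Real.sq_sqrt (by linarith)]
  have hy0 : 0 ≤ y := Real.sqrt_nonneg _
  have hy1 : 1 ≤ y := Real.one_le_sqrt.2 (Real.one_le_sqrt.2 (by linarith))
  have hlog : 0 ≤ Real.log (2 + ((n + 1 : ℕ) : ℝ) ^ 2) := Real.log_nonneg (by nlinarith)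
  have hdiam : √(l1diam (stdSimplex ℝ 𝒩) * (l1diam (stdSimplex ℝ 𝒩)
      + ∑ t ∈ Finset.range (n + 1 - 1), l1norm (a t l - a (t + 1) l))) ≤ √(2 * (2 + Pa)) := by
    refine Real.sqrt_le_sqrt ?_
    exact mul_le_mul hD2 (by linarith) (by linarith) (by norm_num)
  have hroot : √(2 * G * (2 * G + ∑ t ∈ Finset.range (n + 1), ‖g t‖))
      ≤ √(c * (c + M)) * y ^ 3 := by
    have h1 : 2 * G + ∑ t ∈ Finset.range (n + 1), ‖g t‖ ≤ (c + M) * y ^ 4 := by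
      rw [hy2] at hscale
      have h2 : y ^ 2 ≤ y ^ 4 := pow_le_pow_right₀ hy1 (by norm_num)
      have h3 := mul_le_mul_of_nonneg_left h2 hc0
      have h4 : M * S ≤ M * y ^ 4 := mul_le_mul_of_nonneg_left (by linarith) hM
      linarith
    have h2 : 2 * G * (2 * G + ∑ t ∈ Finset.range (n + 1), ‖g t‖)
        ≤ c * (c + M) * (y ^ 3) ^ 2 := by
      rw [hy2] at hscale
      refine (mul_le_mul hscale h1 (by linarith) (by positivity)).trans_eq ?_
      ring
    refine (Real.sqrt_le_sqrt h2).trans_eq ?_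
    rw [Real.sqrt_mul (by positivity), Real.sqrt_sq (by positivity)]
  calc _ ≤ |K| * √(2 * (2 + Pa)) * Real.log (2 + ((n + 1 : ℕ) : ℝ) ^ 2)
        * (√(c * (c + M)) * y ^ 3) := by
        refine mul_le_mul ?_ hroot (Real.sqrt_nonneg _) (by positivity)
        exact mul_le_mul_of_nonneg_right
          (mul_le_mul_of_nonneg_left hdiam (abs_nonneg K)) hlog
    _ = _ := by ring

/-- Compared with the reference allocations, NSO loses at most the sum of the regrets of the
links. -/
theorem sum_drain_ref_le (hM : 0 ≤ M) (hR : 0 ≤ R) (hb : net.IsBounded T M R)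
    (hmu : net.FlowBounded T M mu) (hT : 1 ≤ T) {A : OLOAlgorithm (stdSimplex ℝ 𝒩)} {K : ℝ}
    (hA : IsPFOL A K) {a : ℕ → 𝒩 × 𝒩 → 𝒩 → ℝ}
    (ha : ∀ t < T, ∀ l ∈ net.links, a t l ∈ stdSimplex ℝ 𝒩) {Pa : ℝ}
    (hPa : net.pathLength a T ≤ Pa) {c : ℝ}
    (hc : c = 2 + 4 * M * √(2 * ((Fintype.card 𝒩 : ℝ) ^ 2 * (Fintype.card 𝒩 * M + R)))) :
    ∑ t ∈ Finset.range T, net.drain mu (fun l k => net.cap t l * a t l k) t ≤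
      ∑ t ∈ Finset.range T,
        net.drain mu (fun l k => net.cap t l * net.nsoAction M A mu t l k) t
      + (Fintype.card 𝒩 : ℝ) ^ 2 * (|K| * √(2 * (2 + Pa)) * Real.log (2 + (T : ℝ) ^ 2) *
        √(c * (c + M)) * √√(1 + net.totalQueue mu T) ^ 3) := by
  set H := |K| * √(2 * (2 + Pa)) * Real.log (2 + (T : ℝ) ^ 2) * √(c * (c + M)) *
    √√(1 + net.totalQueue mu T) ^ 3 with hH
  have hH0 : 0 ≤ H := by
    have : 0 ≤ Real.log (2 + (T : ℝ) ^ 2) := Real.log_nonneg (by nlinarith)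
    positivity
  have hpath : ∀ l ∈ net.links,
      ∑ t ∈ Finset.range (T - 1), l1norm (a t l - a (t + 1) l) ≤ Pa := by
    intro l hl
    refine le_trans (Finset.sum_le_sum fun t _ => ?_) hPa
    exact Finset.single_le_sum (f := fun l => l1norm (a t l - a (t + 1) l))
      (fun _ _ => l1norm_nonneg _) hl
  have hlinks : ∑ l ∈ net.links, ∑ t ∈ Finset.range T,
      (net.cap t l • (net.queue mu t l.2 - net.queue mu t l.1)) ⬝ᵥ
        (net.nsoAction M A mu t l - a t l) ≤ (Fintype.card 𝒩 : ℝ) ^ 2 * H := by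
    refine (Finset.sum_le_card_nsmul _ _ H fun l hl =>
      link_regret_le hM hR hb hmu hT hA hl (fun t ht => ha t ht l hl) (hpath l hl) hc).trans ?_
    rw [nsmul_eq_mul]
    refine mul_le_mul_of_nonneg_right ?_ hH0
    have h := Finset.card_le_univ net.links
    rw [Fintype.card_prod] at h
    rw [sq]
    exact_mod_cast h
  have hdiff : ∑ t ∈ Finset.range T, net.drain mu (fun l k => net.cap t l * a t l k) t
      - ∑ t ∈ Finset.range T,
        net.drain mu (fun l k => net.cap t l * net.nsoAction M A mu t l k) t
      = ∑ l ∈ net.links, ∑ t ∈ Finset.range T,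
        (net.cap t l • (net.queue mu t l.2 - net.queue mu t l.1)) ⬝ᵥ
          (net.nsoAction M A mu t l - a t l) := by
    rw [Finset.sum_comm, ← Finset.sum_sub_distrib]
    refine Finset.sum_congr rfl fun t _ => ?_
    rw [drain_eq, drain_eq, sub_sub_sub_cancel_right, ← Finset.sum_sub_distrib]
    refine Finset.sum_congr rfl fun l _ => ?_
    rw [← Finset.sum_sub_distrib]
    refine Finset.sum_congr rfl fun k _ => ?_
    simp only [Pi.smul_apply, Pi.sub_apply, smul_eq_mul]
    ring
  linarith

theorem mul_pow_three_le {h y η : ℝ} (hh : 0 ≤ h) (hy : 0 ≤ y) (hη : 0 < η) :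
    h * y ^ 3 ≤ η * y ^ 4 + h ^ 4 / η ^ 3 := by
  rcases le_total h (η * y) with hle | hle
  · have h1 := mul_le_mul_of_nonneg_right hle (pow_nonneg hy 3)
    have h2 : 0 ≤ h ^ 4 / η ^ 3 := by positivity
    linarith [show η * y * y ^ 3 = η * y ^ 4 by ring]
  · have h1 : y ≤ h / η := by
      rw [le_div_iff₀ hη]
      linarith
    have h2 := mul_le_mul_of_nonneg_left (pow_le_pow_left₀ hy h1 3) hh
    have h3 : 0 ≤ η * y ^ 4 := by positivity
    rw [div_pow, ← mul_div_assoc, show h * h ^ 3 = h ^ 4 by ring] at h2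
    linarith

/-- The pathwise form of the stability bound. Half of the drain provided by the reference
allocations absorbs the regret. -/
theorem mul_totalQueue_le_drain_nso (hM : 0 ≤ M) (hR : 0 ≤ R) (hb : net.IsBounded T M R)
    (hmu : net.FlowBounded T M mu) (hT : 1 ≤ T) {A : OLOAlgorithm (stdSimplex ℝ 𝒩)} {K : ℝ}
    (hA : IsPFOL A K) {CW εW : ℝ} (hε : 0 < εW) {a : ℕ → 𝒩 × 𝒩 → 𝒩 → ℝ}
    (ha : net.PiecewiseStable T CW εW a) {Pa : ℝ} (hPa : net.pathLength a T ≤ Pa) {c : ℝ}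
    (hc : c = 2 + 4 * M * √(2 * ((Fintype.card 𝒩 : ℝ) ^ 2 * (Fintype.card 𝒩 * M + R)))) :
    εW / 2 * net.totalQueue mu T ≤
      ∑ t ∈ Finset.range T,
        net.drain mu (fun l k => net.cap t l * net.nsoAction M A mu t l k) t
      + (Fintype.card 𝒩 : ℝ) ^ 2 * ((Fintype.card 𝒩 * M + R) ^ 2
        + εW * (Fintype.card 𝒩 * M + R)) * (CW * T)
      + (εW / 2 + ((Fintype.card 𝒩 : ℝ) ^ 2 * (|K| * √(2 * (2 + Pa)) *
        Real.log (2 + (T : ℝ) ^ 2) * √(c * (c + M)))) ^ 4 / (εW / 2) ^ 3) := by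
  have h1 := mul_totalQueue_le hM hR hb hmu hε ha
  have h2 := sum_drain_ref_le hM hR hb hmu hT hA ha.1 hPa hc
  have hS0 : 0 ≤ net.totalQueue mu T := Finset.sum_nonneg fun t _ => queueNorm_nonneg t
  have hlog : 0 ≤ Real.log (2 + (T : ℝ) ^ 2) := Real.log_nonneg (by nlinarith)
  have h3 := mul_pow_three_le
    (h := (Fintype.card 𝒩 : ℝ) ^ 2 * (|K| * √(2 * (2 + Pa)) *
        Real.log (2 + (T : ℝ) ^ 2) * √(c * (c + M)))) (y := √√(1 + net.totalQueue mu T))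
    (by positivity) (Real.sqrt_nonneg _) (half_pos hε)
  have hy4 : √√(1 + net.totalQueue mu T) ^ 4 = 1 + net.totalQueue mu T := by
    rw [show ∀ y : ℝ, y ^ 4 = (y ^ 2) ^ 2 from fun y => by ring,
      Real.sq_sqrt (Real.sqrt_nonneg _), Real.sq_sqrt (by linarith)]
  rw [hy4] at h3
  linarith

end Network

/-! ### Taking expectations -/

/-- A bounded function known to the σ-algebra `m` is uncorrelated with a variable centred at its
conditional expectation. -/
theorem integral_mul_sub_condExp_eq_zero {Ω : Type*} {m m0 : MeasurableSpace Ω} {P : Measure Ω}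
    [IsProbabilityMeasure P] (hm : m ≤ m0) {f X Y : Ω → ℝ} (hf : StronglyMeasurable[m] f)
    {B M : ℝ} (hfB : ∀ᵐ ω ∂P, |f ω| ≤ B) (hX : Measurable X)
    (hXM : ∀ᵐ ω ∂P, X ω ∈ Set.Icc 0 M) (hY : P[X | m] =ᵐ[P] Y) :
    Integrable (fun ω => f ω * (X ω - Y ω)) P ∧ ∫ ω, f ω * (X ω - Y ω) ∂P = 0 := by
  have hXint : Integrable X P := by
    refine Integrable.of_bound hX.aestronglyMeasurable M ?_
    filter_upwards [hXM] with ω hω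
    rw [Real.norm_of_nonneg hω.1]
    exact hω.2
  have hfX : Integrable (f * X) P :=
    hXint.bdd_mul (hf.mono hm).aestronglyMeasurable hfB
  have hpull := condExp_mul_of_stronglyMeasurable_left hf hfX hXint
  have hfY : f * P[X | m] =ᵐ[P] f * Y := by
    filter_upwards [hY] with ω hω
    rw [Pi.mul_apply, Pi.mul_apply, hω]
  have hfYint : Integrable (f * Y) P :=
    (integrable_condExp (m := m) (f := f * X)).congr (hpull.trans hfY)
  have heq : ∫ ω, (f * X) ω ∂P = ∫ ω, (f * Y) ω ∂P := by
    rw [← integral_condExp hm]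
    exact integral_congr_ae (hpull.trans hfY)
  simp only [mul_sub]
  refine ⟨hfX.sub hfYint, ?_⟩
  exact (integral_sub hfX hfYint).trans (sub_eq_zero.2 heq)

namespace Network

variable {𝒩 : Type*} [Fintype 𝒩] [DecidableEq 𝒩]

theorem abs_queue_le {net : Network 𝒩} {T : ℕ} {M R : ℝ} {mu : ℕ → 𝒩 × 𝒩 → 𝒩 → ℝ} (hM : 0 ≤ M)
    (hR : 0 ≤ R) (hb : net.IsBounded T M R) (hmu : net.FlowBounded T M mu) {t : ℕ} (ht : t ≤ T)
    (n k : 𝒩) : |net.queue mu t n k| ≤ t * (Fintype.card 𝒩 * M + R) := by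
  induction t with
  | zero => simp [queue]
  | succ t ih =>
    have h1 := ih (by omega)
    have h2 := abs_queue_succ_sub_le hM hR hb hmu (show t < T by omega) n k
    have h3 := abs_sub_abs_le_abs_sub (net.queue mu (t + 1) n k) (net.queue mu t n k)
    push_cast
    linarith

variable {Ω : Type*} [mΩ : MeasurableSpace Ω] {P : Measure Ω} {net : Network 𝒩} {T : ℕ} {M R : ℝ}
  {A : OLOAlgorithm (stdSimplex ℝ 𝒩)} {mu : ℕ → 𝒩 × 𝒩 → 𝒩 → Ω → ℝ}

theorem history_le (hrun : net.IsNSORun P T M A mu) {t : ℕ} (ht : t ≤ T) :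
    net.history mu t ≤ mΩ := by
  refine iSup₂_le fun s hs => iSup₂_le fun l hl => iSup_le fun k => ?_
  exact (hrun.measurable s (hs.trans_le ht) l hl k).comap_le

theorem measurable_history {𝒩 : Type*} (net : Network 𝒩) {Ω : Type*}
    (mu : ℕ → 𝒩 × 𝒩 → 𝒩 → Ω → ℝ) {s t : ℕ} (hst : s < t) {l : 𝒩 × 𝒩} (hl : l ∈ net.links)
    (k : 𝒩) : Measurable[net.history mu t] (mu s l k) := by
  refine Measurable.mono (comap_measurable (mu s l k)) ?_ le_rfl
  exact le_iSup₂_of_le s hst (le_iSup₂_of_le l hl (le_iSup_of_le k le_rfl))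

theorem measurable_queue {𝒩 : Type*} [DecidableEq 𝒩] (net : Network 𝒩) {Ω : Type*}
    (mu : ℕ → 𝒩 × 𝒩 → 𝒩 → Ω → ℝ) {t t' : ℕ} (htt' : t ≤ t') (n k : 𝒩) :
    Measurable[net.history mu t'] fun ω => net.queue (fun s l k => mu s l k ω) t n k := by
  let _ : MeasurableSpace Ω := net.history mu t'
  induction t generalizing n k with
  | zero => exact measurable_const
  | succ t ih =>
    simp only [queue_succ]
    split_ifs
    · exact measurable_const
    · have hflow : ∀ p : 𝒩 × 𝒩 → 𝒩,
          Measurable fun ω => ∑ l ∈ net.links with p l = n, mu t l k ω := fun p =>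
        Finset.measurable_fun_sum _ fun l hl =>
          measurable_history net mu (show t < t' by omega) (Finset.mem_filter.1 hl).1 k
      exact ((((ih (by omega) n k).sub (hflow Prod.fst)).max measurable_const).add
        (hflow Prod.snd)).add measurable_const

theorem ae_flowBounded (hrun : net.IsNSORun P T M A mu) :
    ∀ᵐ ω ∂P, net.FlowBounded T M fun s l k => mu s l k ω := by
  unfold FlowBounded
  simp only [ae_all_iff]
  exact hrun.mem_Icc

variable [IsProbabilityMeasure P]

theorem integrable_totalQueue (hM : 0 ≤ M) (hR : 0 ≤ R) (hb : net.IsBounded T M R)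
    (hrun : net.IsNSORun P T M A mu) :
    Integrable (fun ω => net.totalQueue (fun s l k => mu s l k ω) T) P := by
  unfold totalQueue l1norm
  refine integrable_finsetSum _ fun t ht => integrable_finsetSum _ fun n _ =>
    integrable_finsetSum _ fun k _ => Integrable.abs ?_
  have ht' := (Finset.mem_range.1 ht).le
  refine Integrable.of_bound
    ((measurable_queue net mu le_rfl n k).mono (history_le hrun ht') le_rfl).aestronglyMeasurable
    (t * (Fintype.card 𝒩 * M + R)) ?_
  filter_upwards [ae_flowBounded hrun] with ω hω
  exact abs_queue_le hM hR hb hω ht' n k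

/-- On average, the random transmissions drain the network as much as their conditional means. -/
theorem integral_sum_drain_sub (hM : 0 ≤ M) (hR : 0 ≤ R) (hb : net.IsBounded T M R)
    (hrun : net.IsNSORun P T M A mu) :
    Integrable (fun ω => ∑ t ∈ Finset.range T,
      (net.drain (fun s l k => mu s l k ω) (fun l k => mu t l k ω) t
        - net.drain (fun s l k => mu s l k ω)
          (fun l k => net.cap t l * net.nsoAction M A (fun s l k => mu s l k ω) t l k) t)) P ∧
    ∫ ω, ∑ t ∈ Finset.range T,
      (net.drain (fun s l k => mu s l k ω) (fun l k => mu t l k ω) t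
        - net.drain (fun s l k => mu s l k ω)
          (fun l k => net.cap t l * net.nsoAction M A (fun s l k => mu s l k ω) t l k) t) ∂P
      = 0 := by
  have hterm : ∀ t ∈ Finset.range T, ∀ l ∈ net.links, ∀ k,
      Integrable (fun ω => (net.queue (fun s l k => mu s l k ω) t l.1 k
        - net.queue (fun s l k => mu s l k ω) t l.2 k) *
        (mu t l k ω - net.cap t l * net.nsoAction M A (fun s l k => mu s l k ω) t l k)) P ∧
      ∫ ω, (net.queue (fun s l k => mu s l k ω) t l.1 k
        - net.queue (fun s l k => mu s l k ω) t l.2 k) *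
        (mu t l k ω - net.cap t l * net.nsoAction M A (fun s l k => mu s l k ω) t l k) ∂P = 0 := by
    intro t ht l hl k
    have ht' := Finset.mem_range.1 ht
    refine integral_mul_sub_condExp_eq_zero (history_le hrun ht'.le)
      (f := fun ω => net.queue (fun s l k => mu s l k ω) t l.1 k
        - net.queue (fun s l k => mu s l k ω) t l.2 k)
      (B := t * (Fintype.card 𝒩 * M + R) + t * (Fintype.card 𝒩 * M + R)) ?_ ?_
      (hrun.measurable t ht' l hl k) (hrun.mem_Icc t ht' l hl k) (hrun.condExp_eq t ht' l hl k)
    · exact (Measurable.sub (measurable_queue net mu le_rfl l.1 k)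
        (measurable_queue net mu le_rfl l.2 k)).stronglyMeasurable
    · filter_upwards [ae_flowBounded hrun] with ω hω
      exact (abs_sub _ _).trans (add_le_add (abs_queue_le hM hR hb hω ht'.le _ _)
        (abs_queue_le hM hR hb hω ht'.le _ _))
  have hrw : ∀ ω, ∑ t ∈ Finset.range T,
      (net.drain (fun s l k => mu s l k ω) (fun l k => mu t l k ω) t
        - net.drain (fun s l k => mu s l k ω)
          (fun l k => net.cap t l * net.nsoAction M A (fun s l k => mu s l k ω) t l k) t)
      = ∑ t ∈ Finset.range T, ∑ l ∈ net.links, ∑ k,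
        (net.queue (fun s l k => mu s l k ω) t l.1 k
          - net.queue (fun s l k => mu s l k ω) t l.2 k) *
        (mu t l k ω - net.cap t l * net.nsoAction M A (fun s l k => mu s l k ω) t l k) := by
    intro ω
    refine Finset.sum_congr rfl fun t _ => ?_
    rw [drain_eq, drain_eq, sub_sub_sub_cancel_right, ← Finset.sum_sub_distrib]
    refine Finset.sum_congr rfl fun l _ => ?_
    rw [← Finset.sum_sub_distrib]
    exact Finset.sum_congr rfl fun k _ => (mul_sub _ _ _).symm
  simp only [hrw]
  have hint : ∀ t ∈ Finset.range T, ∀ l ∈ net.links, Integrable (fun ω => ∑ k,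
      (net.queue (fun s l k => mu s l k ω) t l.1 k
        - net.queue (fun s l k => mu s l k ω) t l.2 k) *
      (mu t l k ω - net.cap t l * net.nsoAction M A (fun s l k => mu s l k ω) t l k)) P :=
    fun t ht l hl => integrable_finsetSum _ fun k _ => (hterm t ht l hl k).1
  refine ⟨integrable_finsetSum _ fun t ht => integrable_finsetSum _ (hint t ht), ?_⟩
  rw [integral_finsetSum _ fun t ht => integrable_finsetSum _ (hint t ht)]
  refine Finset.sum_eq_zero fun t ht => ?_
  rw [integral_finsetSum _ (hint t ht)]
  refine Finset.sum_eq_zero fun l hl => ?_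
  rw [integral_finsetSum _ fun k _ => (hterm t ht l hl k).1]
  exact Finset.sum_eq_zero fun k _ => (hterm t ht l hl k).2

/-- The stability bound for a fixed horizon, with reference allocations of path length `Pa`. -/
theorem mul_integral_totalQueue_le (hM : 0 ≤ M) (hR : 0 ≤ R) (hb : net.IsBounded T M R)
    (hrun : net.IsNSORun P T M A mu) (hT : 1 ≤ T) {K : ℝ}
    (hA : IsPFOL A K) {CW εW : ℝ} (hε : 0 < εW) {a : ℕ → 𝒩 × 𝒩 → 𝒩 → ℝ}
    (ha : net.PiecewiseStable T CW εW a) {Pa : ℝ} (hPa : net.pathLength a T ≤ Pa) {c : ℝ}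
    (hc : c = 2 + 4 * M * √(2 * ((Fintype.card 𝒩 : ℝ) ^ 2 * (Fintype.card 𝒩 * M + R)))) :
    εW / 2 * ∫ ω, net.totalQueue (fun s l k => mu s l k ω) T ∂P ≤
      (Fintype.card 𝒩 : ℝ) ^ 2 *
        ((Fintype.card 𝒩 * M) ^ 2 + (Fintype.card 𝒩 * M + R) ^ 2) / 2 * T
      + (Fintype.card 𝒩 : ℝ) ^ 2 * ((Fintype.card 𝒩 * M + R) ^ 2
        + εW * (Fintype.card 𝒩 * M + R)) * (CW * T)
      + (εW / 2 + ((Fintype.card 𝒩 : ℝ) ^ 2 * (|K| * √(2 * (2 + Pa)) *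
        Real.log (2 + (T : ℝ) ^ 2) * √(c * (c + M)))) ^ 4 / (εW / 2) ^ 3) := by
  obtain ⟨hΔint, hΔ⟩ := integral_sum_drain_sub hM hR hb hrun
  have hS := (integrable_totalQueue hM hR hb hrun).const_mul (εW / 2)
  have h := integral_mono_ae (hS.add hΔint) (integrable_const (μ := P) _) (by
    filter_upwards [ae_flowBounded hrun] with ω hω
    have h1 := mul_totalQueue_le_drain_nso hM hR hb hω hT hA hε ha hPa hc
    have h2 := sum_drain_le hM hb hω
    rw [Pi.add_apply, Finset.sum_sub_distrib]
    exact (show _ ≤ (Fintype.card 𝒩 : ℝ) ^ 2 *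
        ((Fintype.card 𝒩 * M) ^ 2 + (Fintype.card 𝒩 * M + R) ^ 2) / 2 * T
      + (Fintype.card 𝒩 : ℝ) ^ 2 * ((Fintype.card 𝒩 * M + R) ^ 2
        + εW * (Fintype.card 𝒩 * M + R)) * (CW * T)
      + (εW / 2 + ((Fintype.card 𝒩 : ℝ) ^ 2 * (|K| * √(2 * (2 + Pa)) *
        Real.log (2 + (T : ℝ) ^ 2) * √(c * (c + M)))) ^ 4 / (εW / 2) ^ 3) by linarith))
  rw [integral_add' hS hΔint, hΔ, integral_const_mul] at h
  simpa using h

end Network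

/-! ### The stability theorem -/

theorem tendsto_log_pow_four_mul_rpow_neg {δ : ℝ} (hδ : 0 < δ) :
    Tendsto (fun T : ℕ => Real.log (2 + (T : ℝ) ^ 2) ^ 4 * (T : ℝ) ^ (-δ)) atTop (𝓝 0) := by
  have h0 : Tendsto (fun T : ℕ => 81 * (Real.log T ^ 4 / (T : ℝ) ^ δ)) atTop (𝓝 0) := by
    have h1 := ((isLittleO_log_rpow_rpow_atTop 4 hδ).tendsto_div_nhds_zero).comp
      tendsto_natCast_atTop_atTop
    have h2 := h1.const_mul 81
    rw [mul_zero] at h2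
    refine h2.congr fun T => ?_
    rw [Function.comp_apply, ← Real.rpow_natCast]
    norm_num
  refine squeeze_zero' (Eventually.of_forall fun T => by positivity) ?_ h0
  filter_upwards [eventually_ge_atTop 2] with T hT
  have hT2 : (2 : ℝ) ≤ T := by exact_mod_cast hT
  have hlog : Real.log (2 + (T : ℝ) ^ 2) ≤ 3 * Real.log T := by
    have h1 : Real.log (2 + (T : ℝ) ^ 2) ≤ Real.log ((T : ℝ) ^ 3) :=
      Real.log_le_log (by positivity) (by nlinarith)
    rwa [Real.log_pow] at h1
  have hlog0 : 0 ≤ Real.log (2 + (T : ℝ) ^ 2) := Real.log_nonneg (by nlinarith)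
  have h4 := pow_le_pow_left₀ hlog0 hlog 4
  rw [Real.rpow_neg (by positivity), ← div_eq_mul_inv, ← mul_div_assoc]
  refine div_le_div_of_nonneg_right ?_ (by positivity)
  linarith [show (3 * Real.log (T : ℝ)) ^ 4 = 81 * Real.log T ^ 4 by ring]

theorem mainTheorem2 :
    ∃ c : ℝ, 0 < c ∧ ∀ (𝒩 : Type*) [Fintype 𝒩] [DecidableEq 𝒩] [Nonempty 𝒩],
      -- base algorithms with the parameter-free guarantee exist on the simplex
      (∃ (K : ℝ) (A : OLOAlgorithm (stdSimplex ℝ 𝒩)), IsPFOL A K) ∧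
      -- NSO with AdaPFOL, built on any of them, stabilizes the network
      ∀ (M R CW εW Ca δa K : ℝ), 0 ≤ M → 0 ≤ R → 0 ≤ CW → 0 < εW → 0 < δa →
        ∃ (r : ℕ → ℝ) (B : ℝ), Tendsto r atTop (𝓝 0) ∧
          ∀ (T : ℕ), 1 ≤ T →
          ∀ (net : Network 𝒩), net.IsBounded T M R →
          ∀ (aRef : ℕ → 𝒩 × 𝒩 → 𝒩 → ℝ), net.PiecewiseStable T CW εW aRef →
          (∀ t ∈ Finset.Icc 1 T, net.pathLength aRef t ≤ Ca * (t : ℝ) ^ (1 / 2 - δa)) →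
          ∀ (A : OLOAlgorithm (stdSimplex ℝ 𝒩)), IsPFOL A K →
          ∀ (Ω : Type*) [MeasurableSpace Ω] (P : Measure Ω) [IsProbabilityMeasure P]
            (mu : ℕ → 𝒩 × 𝒩 → 𝒩 → Ω → ℝ), net.IsNSORun P T M A mu →
          Integrable (fun ω => net.totalQueue (fun s l k => mu s l k ω) T) P ∧
          1 / (T : ℝ) * ∫ ω, net.totalQueue (fun s l k => mu s l k ω) T ∂P ≤
            c * ((((Fintype.card 𝒩 : ℝ) ^ 2 * (2 * Fintype.card 𝒩 * M + R) ^ 2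
                + εW * (Fintype.card 𝒩 : ℝ) ^ 2 * (2 * Fintype.card 𝒩 * M + R)) * CW
                + ((Fintype.card 𝒩 : ℝ) ^ 4 * M ^ 2 + (Fintype.card 𝒩 : ℝ) ^ 2 * R ^ 2)) / εW)
              + r T ∧
          1 / (T : ℝ) * ∫ ω, net.totalQueue (fun s l k => mu s l k ω) T ∂P ≤ B := by
  refine ⟨4, by norm_num, fun 𝒩 _ _ _ => ⟨⟨_, _, isPFOL_gridDescentAlgorithm⟩, ?_⟩⟩
  intro M R CW εW Ca δa K hM hR hCW hε hδ
  set N : ℝ := (Fintype.card 𝒩 : ℝ) with hN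
  have hN0 : 0 ≤ N := Nat.cast_nonneg _
  set X := ((N ^ 2 * (2 * N * M + R) ^ 2 + εW * N ^ 2 * (2 * N * M + R)) * CW
    + (N ^ 4 * M ^ 2 + N ^ 2 * R ^ 2)) / εW with hX
  set c' := 2 + 4 * M * √(2 * (N ^ 2 * (N * M + R))) with hc'
  have hc'0 : 0 ≤ c' := by positivity
  -- Decreasing `δa` to at most `1 / 4` weakens the bound on the path length and makes the exponent
  -- `1 / 2 - δ` positive.
  set δ := min δa (1 / 4) with hδdef
  have hδ0 : 0 < δ := lt_min hδ (by norm_num)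
  have hδ4 : δ ≤ 1 / 4 := min_le_right _ _
  set C := (N ^ 2 * |K|) ^ 4 * (2 * (2 + |Ca|)) ^ 2 * (c' * (c' + M)) ^ 2 / (εW / 2) ^ 3 with hC
  set r : ℕ → ℝ := fun T => 2 / εW * (εW / 2 * (T : ℝ)⁻¹
    + C * (Real.log (2 + (T : ℝ) ^ 2) ^ 4 * (T : ℝ) ^ (-(2 * δ)))) with hr
  have hr0 : Tendsto r atTop (𝓝 0) := by
    have h1 : Tendsto (fun T : ℕ => (T : ℝ)⁻¹) atTop (𝓝 0) := tendsto_inv_atTop_nhds_zero_nat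
    have h2 := tendsto_log_pow_four_mul_rpow_neg (show 0 < 2 * δ by positivity)
    have h3 := ((h1.const_mul (εW / 2)).add (h2.const_mul C)).const_mul (2 / εW)
    simpa using h3
  obtain ⟨B, hB⟩ := hr0.bddAbove_range
  refine ⟨r, 4 * X + B, hr0, ?_⟩
  intro T hT net hb aRef hstable hpath A hA Ω _ P _ mu hrun
  have hT1 : (1 : ℝ) ≤ T := by exact_mod_cast hT
  have hT0 : (0 : ℝ) < T := by linarith
  set p : ℝ := (T : ℝ) ^ (1 / 2 - δ) with hp
  have hp1 : 1 ≤ p := Real.one_le_rpow hT1 (by linarith)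
  -- The bound on the path length is chosen so that `2` plus it is a multiple of `p`.
  have hPa : net.pathLength aRef T ≤ (2 + |Ca|) * p - 2 := by
    have h1 := hpath T (Finset.mem_Icc.2 ⟨hT, le_rfl⟩)
    have h2 : (T : ℝ) ^ (1 / 2 - δa) ≤ p :=
      Real.rpow_le_rpow_of_exponent_le hT1 (by linarith [min_le_left δa (1 / 4)])
    have h3 : Ca * (T : ℝ) ^ (1 / 2 - δa) ≤ |Ca| * p :=
      mul_le_mul (le_abs_self Ca) h2 (by positivity) (abs_nonneg Ca)
    linarith
  have hmain := Network.mul_integral_totalQueue_le hM hR hb hrun hT hA hε hstable hPa hc'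
  rw [← hN] at hmain
  have hpow : (N ^ 2 * (|K| * √(2 * (2 + ((2 + |Ca|) * p - 2))) *
      Real.log (2 + (T : ℝ) ^ 2) * √(c' * (c' + M)))) ^ 4 / (εW / 2) ^ 3
      = C * (Real.log (2 + (T : ℝ) ^ 2) ^ 4 * p ^ 2) := by
    have hs : ∀ z : ℝ, 0 ≤ z → √z ^ 4 = z ^ 2 := fun z hz => by
      rw [show √z ^ 4 = (√z ^ 2) ^ 2 by ring, Real.sq_sqrt hz]
    have e : 2 * (2 + ((2 + |Ca|) * p - 2)) = 2 * (2 + |Ca|) * p := by ring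
    rw [e, mul_pow, mul_pow, mul_pow, mul_pow, hs _ (by positivity), hs _ (by positivity), hC]
    ring
  have hp2 : p ^ 2 = T * (T : ℝ) ^ (-(2 * δ)) := by
    rw [hp, ← Real.rpow_natCast, ← Real.rpow_mul hT0.le]
    nth_rewrite 2 [← Real.rpow_one (T : ℝ)]
    rw [← Real.rpow_add hT0]
    congr 1
    push_cast
    ring
  rw [hpow, hp2] at hmain
  have hbound : 1 / (T : ℝ) * ∫ ω, net.totalQueue (fun s l k => mu s l k ω) T ∂P
      ≤ 4 * X + r T := by
    set I := ∫ ω, net.totalQueue (fun s l k => mu s l k ω) T ∂P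
    have h1 : 1 / (T : ℝ) * I ≤ 2 / εW * (N ^ 2 * ((N * M) ^ 2 + (N * M + R) ^ 2) / 2
        + N ^ 2 * ((N * M + R) ^ 2 + εW * (N * M + R)) * CW) + r T := by
      have h2 := mul_le_mul_of_nonneg_left hmain
        (show 0 ≤ 1 / (T : ℝ) * (2 / εW) by positivity)
      refine le_of_eq_of_le ?_ (h2.trans_eq ?_)
      · field_simp
      · rw [hr]
        field_simp
    have h2 : 2 / εW * (N ^ 2 * ((N * M) ^ 2 + (N * M + R) ^ 2) / 2
        + N ^ 2 * ((N * M + R) ^ 2 + εW * (N * M + R)) * CW) ≤ 4 * X := by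
      rw [hX, div_mul_eq_mul_div, ← mul_div_assoc]
      refine div_le_div_of_nonneg_right ?_ hε.le
      have hNM : 0 ≤ N * M := mul_nonneg hN0 hM
      have h3 : N ^ 2 * ((N * M) ^ 2 + (N * M + R) ^ 2)
          ≤ 4 * (N ^ 4 * M ^ 2 + N ^ 2 * R ^ 2) := by
        have h5 : (N * M) ^ 2 + (N * M + R) ^ 2 ≤ 4 * ((N * M) ^ 2 + R ^ 2) := by
          nlinarith [sq_nonneg (N * M - R)]
        linarith [mul_le_mul_of_nonneg_left h5 (sq_nonneg N),
          show N ^ 2 * (4 * ((N * M) ^ 2 + R ^ 2)) = 4 * (N ^ 4 * M ^ 2 + N ^ 2 * R ^ 2) by ring]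
      have h4 : N ^ 2 * ((N * M + R) ^ 2 + εW * (N * M + R)) * CW
          ≤ (N ^ 2 * (2 * N * M + R) ^ 2 + εW * N ^ 2 * (2 * N * M + R)) * CW := by
        refine mul_le_mul_of_nonneg_right ?_ hCW
        have h5 : N * M + R ≤ 2 * N * M + R := by linarith
        have h6 := pow_le_pow_left₀ (by positivity) h5 2
        have h7 := mul_le_mul_of_nonneg_left h5 hε.le
        have h8 := mul_le_mul_of_nonneg_left (add_le_add h6 h7) (sq_nonneg N)
        linarith
      have h5 : 0 ≤ (N ^ 2 * (2 * N * M + R) ^ 2 + εW * N ^ 2 * (2 * N * M + R)) * CW := by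
        positivity
      linarith
    linarith
  exact ⟨Network.integrable_totalQueue hM hR hb hrun, hbound,
    hbound.trans (by linarith [hB ⟨T, rfl⟩])⟩
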